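/- **Theorem 1.3.** There exist absolute constants $c_0, c_1 > 0$ such that the following holds. Let $n \ge 2$ and let $X$ be a random vector in $\mathbb{R}^n$ which is isotropic, i.e. $\mathbb{E} X_i X_j = \delta_{ij}$ for all $i,j \le n$, and satisfies $|X| \le b\sqrt{n}$ almost surely for some $b \in \mathbb{R}$, where $|\cdot|$ is the Euclidean norm. For $\theta$ in the unit sphere $\mathbb{S}^{n-1}$ let $F_\theta(x) = \mathbb{P}\{\langle X,\theta\rangle \le x\}$, let $\Phi$ be the standard normal distribution function, let $\mathbb{E}_\theta$ denote integration over $\mathbb{S}^{n-1}$ with respect to the uniform probability measure, and put $$\rho(F_\theta,\Phi) = \sup_{x\in\mathbb{R}} |F_\theta(x)-\Phi(x)|, \qquad \omega(F_\theta,\Phi) = \Big(\int_{-\infty}^{\infty} (F_\theta(x)-\Phi(x))^2\,dx\Big)^{1/2},$$ $$\sigma_4 = \Big(\frac{1}{n}\operatorname{Var}(|X|^2)\Big)^{1/2}.$$ If, for some $D > 0$, $$\mathbb{E}_\theta\, \omega^2(F_\theta,\Phi) \ge \frac{D}{n},$$ then $$\mathbb{E}_\theta\, \rho(F_\theta,\Phi)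 \ge \frac{c_0}{(1+\sigma_4)^3\, b^2}\,\frac{D^2}{(\log n)^4 \sqrt{n}} - \frac{c_1(1+\sigma_4^2)}{n}.$$ -/

import Mathlib

open MeasureTheory ProbabilityTheory
open scoped RealInnerProductSpace

noncomputable section

namespace RandomizedCLT

/-- The normalized Lebesgue (uniform) measure on the unit sphere of `ℝⁿ`. Mathlib's
`volume.toSphere` is the surface measure; it is divided here by its total mass. -/
def sphereMeasure (n : ℕ) : Measure (Metric.sphere (0 : EuclideanSpace ℝ (Fin n)) 1) :=
  ((volume : Measure (EuclideanSpace ℝ (Fin n))).toSphere Set.univ)⁻¹ •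
    (volume : Measure (EuclideanSpace ℝ (Fin n))).toSphere

/-- `X` is isotropic: `E X_i X_j = δ_{ij}`. For measurable `X` the case `i = j` already forces
`X_i ∈ L²`, since the integral of a non-integrable function is `0` by convention. -/
def IsIsotropic {Ω : Type*} [MeasurableSpace Ω] (P : Measure Ω) {n : ℕ}
    (X : Ω → EuclideanSpace ℝ (Fin n)) : Prop :=
  ∀ i j : Fin n, ∫ ω, X ω i * X ω j ∂P = if i = j then 1 else 0

/-- The distribution function `F_θ(x) = P{⟨X, θ⟩ ≤ x}` of the weighted sum `⟨X, θ⟩`. -/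
def weightedSumCDF {Ω : Type*} [MeasurableSpace Ω] (P : Measure Ω) {n : ℕ}
    (X : Ω → EuclideanSpace ℝ (Fin n)) (θ : EuclideanSpace ℝ (Fin n)) (x : ℝ) : ℝ :=
  P.real {ω | ⟪X ω, θ⟫ ≤ x}

/-- The standard normal distribution function `Φ`. -/
def stdNormalCDF (x : ℝ) : ℝ := cdf (gaussianReal 0 1) x

/-- The Kolmogorov distance `ρ(F, G) = sup_x |F(x) - G(x)|`. -/
def kolmogorovDist (F G : ℝ → ℝ) : ℝ := ⨆ x : ℝ, |F x - G x|

/-- The `L²`-distance `ω(F, G) = (∫ (F(x) - G(x))² dx)^{1/2}`. -/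
def l2Dist (F G : ℝ → ℝ) : ℝ := √(∫ x : ℝ, (F x - G x) ^ 2)

/-- The functional `σ₄(X) ≥ 0` with `σ₄² = Var(|X|²) / n`. -/
def sigma4 {Ω : Type*} [MeasurableSpace Ω] (P : Measure Ω) {n : ℕ}
    (X : Ω → EuclideanSpace ℝ (Fin n)) : ℝ :=
  √(variance (fun ω => ‖X ω‖ ^ 2) P / n)

end RandomizedCLT

end

open scoped ENNReal NNReal

noncomputable section

namespace RandomizedCLT

/-! Let `f_θ` be the characteristic function of `⟨X, θ⟩`, `s = 1 + σ₄` and `L = log n`. Plancherel's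
theorem turns `2π ω²(F_θ, Φ)` into `∫ |f_θ(t) - e^{-t²/2}|² t⁻² dt` (`lintegral_cdf_sub_cdf_sq`).
Let `V_θ` be the part of this integral over `|t| ≤ T`.

High frequencies are negligible on average: `E_θ |f_θ(t)|²` is nearly Gaussian up to `O(s²/n)`, so
the part `|t| > T` contributes `O(T⁻¹(e^{-T²/64} + s²/n))` (`lintegral_sphere_tail_le`). With `T` of
order `L² s²/D` this is at most `D/n`, and hence `E_θ V_θ` is still at least of order `D/n`.

Low frequencies concentrate: the characteristic function of an isotropic law is 1-Lipschitz in every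
dimension, so the Maurey–Pisier inequality bounds the sixth moment of `f_θ(t) - e^{-t²/2}`, and `E_θ
V_θ³ ≲ T³ s⁶/n³`. Thus `V_θ` cannot owe its mean to rare directions.

The link with `ρ` is a dichotomy. For `l > 0`, either `V_θ ≤ l²`, and then `V_θ ≤ 2πω²` gives `V_θ ≤
3lω`; or `V_θ ≤ V_θ³/l⁴`, which is controlled by the third moment. Also `ω ≤ κρ` up to tails, by
integrating over an interval of length `κ²`; `|X| ≤ b√n` makes these tails exponentially small on
average. Together, `D/n ≲ lκ E_θ ρ + errors`; taking `l` of order `L² s³/(D√n)` and `κ` of order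
`bL²` gives the bound.

Integrals over the sphere are dominated by integrals over a standard Gaussian vector restricted to
an annulus (`lintegral_sphereMeasure_le`), since its direction is uniform. All averaging is then
Gaussian computation. -/

/-! ### Moments of the one-dimensional Gaussian. -/

/-- Truncated Taylor series of `cosh`. Together with `E cosh = e^{1/2}` it bounds Gaussian moments
without computing them; crude numerical values suffice. -/
lemma one_add_sq_add_pow_four_le_cosh (x : ℝ) : 1 + x ^ 2 / 2 + x ^ 4 / 24 ≤ Real.cosh x := by
  have h := sum_le_hasSum (Finset.range 3) (fun i _ ↦ by
    have : 0 ≤ x ^ (2 * i) := by rw [pow_mul]; positivity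
    positivity) (Real.hasSum_cosh x)
  norm_num [Finset.sum_range_succ, Nat.factorial] at h
  linarith

lemma pow_six_le_cosh (x : ℝ) : x ^ 6 ≤ 720 * Real.cosh x := by
  have h := le_hasSum (Real.hasSum_cosh x) 3 (fun i _ ↦ by
    have : 0 ≤ x ^ (2 * i) := by rw [pow_mul]; positivity
    positivity)
  norm_num [Nat.factorial] at h
  linarith

lemma integrable_pow_gaussianReal (k : ℕ) : Integrable (fun x : ℝ ↦ x ^ k) (gaussianReal 0 1) := by
  have h := (memLp_id_gaussianReal' (μ := 0) (v := 1) k (by simp)).integrable_norm_pow'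
  refine h.mono' (by fun_prop) (Filter.Eventually.of_forall fun x ↦ ?_)
  simp

lemma integrable_cosh_gaussianReal : Integrable Real.cosh (gaussianReal 0 1) := by
  have h1 := integrable_exp_mul_gaussianReal (μ := 0) (v := 1) 1
  have h2 := integrable_exp_mul_gaussianReal (μ := 0) (v := 1) (-1)
  refine ((h1.add h2).div_const 2).congr (Filter.Eventually.of_forall fun x ↦ ?_)
  simp [Real.cosh_eq]

lemma integral_cosh_gaussianReal :
    ∫ x, Real.cosh x ∂(gaussianReal 0 1) = Real.exp (1 / 2) := by
  have h1 := integrable_exp_mul_gaussianReal (μ := 0) (v := 1) 1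
  have h2 := integrable_exp_mul_gaussianReal (μ := 0) (v := 1) (-1)
  have e (t : ℝ) := congrFun (mgf_id_gaussianReal (μ := 0) (v := 1)) t
  simp only [mgf, id] at e
  simp_rw [Real.cosh_eq, integral_div]
  have : ∀ x : ℝ, Real.exp x + Real.exp (-x) = Real.exp (1 * x) + Real.exp ((-1) * x) := by
    intro x; simp
  simp_rw [this]
  rw [integral_add h1 h2, e, e]
  norm_num

lemma exp_half_le : Real.exp (1 / 2) ≤ 1.6488 := by
  have h : Real.exp (1 / 2) ^ 2 = Real.exp 1 := by rw [← Real.exp_nat_mul]; norm_num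
  have := Real.exp_one_lt_d9
  by_contra! hc
  nlinarith

lemma integral_sq_gaussianReal : ∫ x, x ^ 2 ∂(gaussianReal 0 1) = 1 := by
  have h := variance_fun_id_gaussianReal (μ := 0) (v := 1)
  rw [variance_eq_integral (by fun_prop)] at h
  simpa using h

/-- The exact value is 3; any bound up to 4.375 would serve in the annulus estimate. -/
lemma integral_pow_four_gaussianReal_le : ∫ x, x ^ 4 ∂(gaussianReal 0 1) ≤ 3.58 := by
  have h : ∫ x : ℝ, 1 + x ^ 2 / 2 + x ^ 4 / 24 ∂(gaussianReal 0 1) ≤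
      ∫ x, Real.cosh x ∂(gaussianReal 0 1) :=
    integral_mono (((integrable_const _).add ((integrable_pow_gaussianReal 2).div_const _)).add
      ((integrable_pow_gaussianReal 4).div_const _)) integrable_cosh_gaussianReal
      one_add_sq_add_pow_four_le_cosh
  have h2 := (integrable_pow_gaussianReal 2).div_const 2
  have h4 := (integrable_pow_gaussianReal 4).div_const 24
  have e : ∫ x : ℝ, 1 + x ^ 2 / 2 + x ^ 4 / 24 ∂(gaussianReal 0 1) =
      1 + 1 / 2 + (∫ x : ℝ, x ^ 4 ∂(gaussianReal 0 1)) / 24 := by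
    rw [integral_add (by fun_prop) h4, integral_add (by fun_prop) h2, integral_div, integral_div,
      integral_sq_gaussianReal]
    simp
  rw [e, integral_cosh_gaussianReal] at h
  have := exp_half_le
  norm_num at this h ⊢
  linarith

lemma integral_pow_six_gaussianReal_le : ∫ x, x ^ 6 ∂(gaussianReal 0 1) ≤ 1440 := by
  have h : ∫ x : ℝ, x ^ 6 ∂(gaussianReal 0 1) ≤
      ∫ x, 720 * Real.cosh x ∂(gaussianReal 0 1) :=
    integral_mono (integrable_pow_gaussianReal 6) (integrable_cosh_gaussianReal.const_mul _)
      pow_six_le_cosh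
  rw [integral_const_mul, integral_cosh_gaussianReal] at h
  have := exp_half_le
  linarith

/-! ### The standard Gaussian measure on a Euclidean space. -/

/-- Power mean inequality for the squared coordinates; it reduces moments of the norm to
one-dimensional moments. -/
lemma norm_sq_pow_le {E : Type*} [NormedAddCommGroup E] [InnerProductSpace ℝ E]
    [FiniteDimensional ℝ E] (x : E) (k : ℕ) :
    ‖x‖ ^ (2 * (k + 1)) ≤ (Module.finrank ℝ E : ℝ) ^ k *
      ∑ i, ⟪stdOrthonormalBasis ℝ E i, x⟫ ^ (2 * (k + 1)) := by
  rw [pow_mul, ← (stdOrthonormalBasis ℝ E).sum_sq_inner_right x]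
  simp_rw [pow_mul _ 2 (k + 1)]
  have h := pow_sum_div_card_le_sum_pow (s := Finset.univ)
    (f := fun i ↦ ⟪stdOrthonormalBasis ℝ E i, x⟫ ^ 2) (fun i _ ↦ sq_nonneg _) k
  rcases Nat.eq_zero_or_pos (Module.finrank ℝ E) with h0 | h0
  · have : IsEmpty (Fin (Module.finrank ℝ E)) := by rw [h0]; infer_instance
    simp
  · rw [div_le_iff₀ (by simp; positivity)] at h
    simpa [mul_comm] using h

section

variable {E : Type*} [NormedAddCommGroup E] [InnerProductSpace ℝ E] [FiniteDimensional ℝ E]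
  [MeasurableSpace E] [BorelSpace E]

lemma stdGaussian_map_inner (a : E) :
    (stdGaussian E).map (fun y ↦ ⟪a, y⟫) = (gaussianReal 0 1).map (fun x ↦ ‖a‖ * x) := by
  have : IsProbabilityMeasure ((stdGaussian E).map (fun y ↦ ⟪a, y⟫)) :=
    Measure.isProbabilityMeasure_map (by fun_prop)
  have : IsProbabilityMeasure ((gaussianReal 0 1).map (fun x ↦ ‖a‖ * x)) :=
    Measure.isProbabilityMeasure_map (by fun_prop)
  apply Measure.ext_of_charFun
  ext t
  rw [charFun_map_mul, charFun_gaussianReal, charFun_apply_real,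
    integral_map (by fun_prop) (by fun_prop)]
  have : ∀ y : E, Complex.exp (t * (⟪a, y⟫ : ℝ) * Complex.I) =
      Complex.exp ((⟪y, t • a⟫ : ℝ) * Complex.I) := by
    intro y
    rw [inner_smul_right, real_inner_comm]
    push_cast
    rfl
  simp_rw [this]
  rw [← charFun_apply, charFun_stdGaussian]
  congr 1
  rw [norm_smul]
  simp only [Real.norm_eq_abs, Complex.ofReal_mul, mul_pow, ← Complex.ofReal_pow, sq_abs]
  simp
  ring

lemma integrable_inner_pow_stdGaussian (a : E) (k : ℕ) :
    Integrable (fun y ↦ ⟪a, y⟫ ^ k) (stdGaussian E) := by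
  have h : Integrable (fun x : ℝ ↦ x ^ k) ((stdGaussian E).map (fun y ↦ ⟪a, y⟫)) := by
    rw [stdGaussian_map_inner, integrable_map_measure (by fun_prop) (by fun_prop)]
    simpa [Function.comp_def, mul_pow] using (integrable_pow_gaussianReal k).const_mul _
  rwa [integrable_map_measure (by fun_prop) (by fun_prop)] at h

lemma integral_inner_pow_stdGaussian (a : E) (k : ℕ) :
    ∫ y, ⟪a, y⟫ ^ k ∂(stdGaussian E) = ‖a‖ ^ k * ∫ x, x ^ k ∂(gaussianReal 0 1) := by
  have h : ∫ x, x ^ k ∂((stdGaussian E).map (fun y ↦ ⟪a, y⟫)) =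
      ∫ y, ⟪a, y⟫ ^ k ∂(stdGaussian E) := integral_map (by fun_prop) (by fun_prop)
  rw [← h, stdGaussian_map_inner, integral_map (by fun_prop) (by fun_prop), ← integral_const_mul]
  simp_rw [mul_pow]

lemma lintegral_inner_pow_six_stdGaussian_le (a : E) :
    ∫⁻ y, ENNReal.ofReal (⟪a, y⟫ ^ 6) ∂(stdGaussian E) ≤ ENNReal.ofReal (1440 * ‖a‖ ^ 6) := by
  rw [← ofReal_integral_eq_lintegral_ofReal (integrable_inner_pow_stdGaussian a 6)
    (Filter.Eventually.of_forall fun y ↦ by positivity), integral_inner_pow_stdGaussian]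
  apply ENNReal.ofReal_le_ofReal
  nlinarith [integral_pow_six_gaussianReal_le, pow_nonneg (norm_nonneg a) 6]

lemma integrable_norm_pow_stdGaussian (k : ℕ) :
    Integrable (fun x : E ↦ ‖x‖ ^ k) (stdGaussian E) :=
  (IsGaussian.memLp_id (stdGaussian E) k (by simp)).integrable_norm_pow'

lemma integral_norm_pow_stdGaussian_le (k : ℕ) :
    ∫ x : E, ‖x‖ ^ (2 * (k + 1)) ∂(stdGaussian E) ≤
      (Module.finrank ℝ E : ℝ) ^ (k + 1) * ∫ x, x ^ (2 * (k + 1)) ∂(gaussianReal 0 1) := by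
  have hi (i) := integrable_inner_pow_stdGaussian (stdOrthonormalBasis ℝ E i) (2 * (k + 1))
  refine (integral_mono (integrable_norm_pow_stdGaussian _)
    ((integrable_finsetSum _ fun i _ ↦ hi i).const_mul _) fun x ↦ norm_sq_pow_le x k).trans ?_
  rw [integral_const_mul, integral_finsetSum _ fun i _ ↦ hi i]
  simp_rw [integral_inner_pow_stdGaussian]
  simp [pow_succ, mul_assoc]

lemma integral_norm_sq_stdGaussian :
    ∫ x : E, ‖x‖ ^ 2 ∂(stdGaussian E) = Module.finrank ℝ E := by
  simp_rw [← (stdOrthonormalBasis ℝ E).sum_sq_inner_right]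
  rw [integral_finsetSum _ fun i _ ↦ integrable_inner_pow_stdGaussian _ 2]
  simp_rw [integral_inner_pow_stdGaussian, integral_sq_gaussianReal]
  simp

/-- The standard Gaussian measure gives mass at least `1 / 8` to the annulus
`√dim / 2 ≤ ‖x‖ ≤ 4 √dim`. -/
lemma one_eighth_le_stdGaussian_annulus (hE : 0 < Module.finrank ℝ E) :
    1 / 8 ≤ (stdGaussian E).real {x | √(Module.finrank ℝ E) / 2 ≤ ‖x‖ ∧
      ‖x‖ ≤ 4 * √(Module.finrank ℝ E)} := by
  set d : ℝ := (Module.finrank ℝ E : ℝ) with hd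
  have hd0 : 0 < d := by simpa [hd] using hE
  set A := {x : E | √d / 2 ≤ ‖x‖ ∧ ‖x‖ ≤ 4 * √d} with hA
  have hAm : MeasurableSet A :=
    (measurableSet_le measurable_const measurable_norm).inter
      (measurableSet_le measurable_norm measurable_const)
  have hsq : √d ^ 2 = d := Real.sq_sqrt hd0.le
  have hs0 : 0 ≤ √d := Real.sqrt_nonneg d
  -- The numerator is `(‖x‖² - d/4)(16d - ‖x‖²)`: nonpositive off the annulus, and at most `(63d/8)²
  -- ≤ 63d²` everywhere. Its mean is at least `(65/4 - 3.58 - 4)d²`, which exceeds `63d²/8`.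
  have key : ∀ x : E, (65 / 4 * d * ‖x‖ ^ 2 - ‖x‖ ^ 4 - 4 * d ^ 2) / (63 * d ^ 2) ≤
      A.indicator (fun _ ↦ (1 : ℝ)) x := by
    intro x
    by_cases hx : x ∈ A
    · rw [Set.indicator_of_mem hx, div_le_iff₀ (by positivity)]
      nlinarith [sq_nonneg (‖x‖ ^ 2 - 65 / 8 * d), sq_nonneg d]
    · rw [Set.indicator_of_notMem hx]
      apply div_nonpos_of_nonpos_of_nonneg _ (by positivity)
      have e : 65 / 4 * d * ‖x‖ ^ 2 - ‖x‖ ^ 4 - 4 * d ^ 2 =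
          (‖x‖ ^ 2 - d / 4) * (16 * d - ‖x‖ ^ 2) := by ring
      rw [e]
      have hn := norm_nonneg x
      rw [hA, Set.mem_ofPred_eq, not_and_or, not_le, not_le] at hx
      rcases hx with hx | hx
      · exact mul_nonpos_of_nonpos_of_nonneg (by nlinarith) (by nlinarith)
      · exact mul_nonpos_of_nonneg_of_nonpos (by nlinarith) (by nlinarith)
  have i2 := integrable_norm_pow_stdGaussian (E := E) 2
  have i4 := integrable_norm_pow_stdGaussian (E := E) 4
  have h := integral_mono (((((i2.const_mul (65 / 4 * d)).sub i4).sub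
    (integrable_const (4 * d ^ 2))).div_const (63 * d ^ 2)))
    ((integrable_const (1 : ℝ)).indicator hAm) key
  rw [integral_indicator_const _ hAm, smul_eq_mul, mul_one] at h
  refine le_trans ?_ h
  simp only [Pi.sub_apply]
  rw [integral_div, integral_sub (by fun_prop) (by fun_prop), integral_sub (by fun_prop) i4,
    integral_const_mul, integral_norm_sq_stdGaussian]
  have h4 := integral_norm_pow_stdGaussian_le (E := E) 1
  have := integral_pow_four_gaussianReal_le
  norm_num at h4 this ⊢
  rw [← hd] at h4 ⊢
  rw [le_div_iff₀ (by positivity)]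
  nlinarith [mul_le_mul_of_nonneg_left this (sq_nonneg d)]

/-! ### Polar coordinates and comparison of the sphere with the Gaussian measure. -/

lemma stdGaussian_eq_withDensity :
    stdGaussian E = volume.withDensity fun x : E ↦
      ENNReal.ofReal ((2 * Real.pi) ^ (-(Module.finrank ℝ E : ℝ) / 2) *
        Real.exp (-(‖x‖ ^ 2 / 2))) := by
  set c := (2 * Real.pi) ^ (-(Module.finrank ℝ E : ℝ) / 2) with hc
  have hc0 : 0 < c := by positivity
  have hint : Integrable (fun x : E ↦ c * Real.exp (-(‖x‖ ^ 2 / 2))) := by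
    have h := (GaussianFourier.integrable_cexp_neg_mul_sq_norm_add (V := E) (b := 1 / 2)
      (by norm_num) 0 0).norm
    refine (h.const_mul c).congr (Filter.Eventually.of_forall fun x ↦ ?_)
    simp [Complex.norm_exp, ← Complex.ofReal_pow]
    left
    ring_nf
  have : IsFiniteMeasure (volume.withDensity fun x : E ↦
      ENNReal.ofReal (c * Real.exp (-(‖x‖ ^ 2 / 2)))) :=
    isFiniteMeasure_withDensity_ofReal hint.2
  apply Measure.ext_of_charFun
  ext t
  rw [charFun_stdGaussian, charFun_apply, integral_withDensity_eq_integral_toReal_smul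
    (by fun_prop) (by simp)]
  have e : ∀ x : E, (ENNReal.ofReal (c * Real.exp (-(‖x‖ ^ 2 / 2)))).toReal •
      Complex.exp ((⟪x, t⟫ : ℝ) * Complex.I) =
      c * Complex.exp (-(1 / 2 : ℂ) * ‖x‖ ^ 2 + Complex.I * (⟪t, x⟫ : ℝ)) := by
    intro x
    rw [ENNReal.toReal_ofReal (by positivity), Complex.real_smul, Complex.exp_add, real_inner_comm]
    push_cast
    ring_nf
  simp_rw [e]
  rw [integral_const_mul, GaussianFourier.integral_cexp_neg_mul_sq_norm_add (by norm_num)]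
  have h1 : (Real.pi / (1 / 2) : ℂ) ^ (Module.finrank ℝ E / 2 : ℂ) =
      (((2 * Real.pi) ^ ((Module.finrank ℝ E : ℝ) / 2) : ℝ) : ℂ) := by
    rw [Complex.ofReal_cpow (by positivity)]
    push_cast
    ring_nf
  rw [h1, ← mul_assoc, ← Complex.ofReal_mul, hc, ← Real.rpow_add (by positivity)]
  simp [neg_div]
  ring_nf

lemma lintegral_polar [Nontrivial E] {F : E → ℝ≥0∞} (hF : Measurable F) {h : ℝ → ℝ≥0∞}
    (hh : Measurable h) :
    ∫⁻ x : E, F (‖x‖⁻¹ • x) * h ‖x‖ =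
      (∫⁻ θ : Metric.sphere (0 : E) 1, F θ ∂(volume : Measure E).toSphere) *
        ∫⁻ r : Set.Ioi (0 : ℝ), h r ∂(Measure.volumeIoiPow (Module.finrank ℝ E - 1)) := by
  have hmp := (volume : Measure E).measurePreserving_homeomorphUnitSphereProd
  rw [← lintegral_prod_mul (by fun_prop) (by fun_prop),
    ← hmp.lintegral_comp (by fun_prop),
    ← setLIntegral_univ, ← setLIntegral_congr (s := {0}ᶜ) (by
      rw [ae_eq_univ]; simp),
    ← lintegral_subtype_comap (measurableSet_singleton _).compl]
  refine lintegral_congr fun x ↦ ?_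
  simp

end

/-- The annulus `√n / 2 ≤ ‖x‖ ≤ 4 √n`. -/
def annulus (n : ℕ) : Set (EuclideanSpace ℝ (Fin n)) :=
  {x | √n / 2 ≤ ‖x‖ ∧ ‖x‖ ≤ 4 * √n}

lemma measurableSet_annulus (n : ℕ) : MeasurableSet (annulus n) :=
  (measurableSet_le measurable_const measurable_norm).inter
    (measurableSet_le measurable_norm measurable_const)

/-- Under the Gaussian measure the direction `x/‖x‖` is uniform and independent of `‖x‖`. The right
side is therefore 8 times the Gaussian mass of the annulus times the left side, and that mass is at
least `1/8`. Restricting to the annulus keeps `‖x‖` comparable to `√n` in later estimates. -/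
lemma lintegral_sphereMeasure_le {n : ℕ} (hn : 0 < n) {F : EuclideanSpace ℝ (Fin n) → ℝ≥0∞}
    (hF : Measurable F) :
    ∫⁻ θ, F θ ∂(sphereMeasure n) ≤
      8 * ∫⁻ x in annulus n, F (‖x‖⁻¹ • x) ∂(stdGaussian (EuclideanSpace ℝ (Fin n))) := by
  have : Nonempty (Fin n) := ⟨⟨0, hn⟩⟩
  have : Nontrivial (EuclideanSpace ℝ (Fin n)) :=
    Module.nontrivial_of_finrank_pos (R := ℝ) (by simpa using hn)
  let h : ℝ → ℝ≥0∞ := fun r ↦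
    (Set.Icc (√n / 2) (4 * √n)).indicator (fun _ ↦ 1) r *
      ENNReal.ofReal ((2 * Real.pi) ^ (-(n : ℝ) / 2) * Real.exp (-(r ^ 2 / 2)))
  have hh : Measurable h :=
    (measurable_const.indicator measurableSet_Icc).mul (by fun_prop)
  let κ := ∫⁻ r : Set.Ioi (0 : ℝ), h r ∂(Measure.volumeIoiPow (n - 1))
  have polar {F : EuclideanSpace ℝ (Fin n) → ℝ≥0∞} (hF : Measurable F) :
      ∫⁻ x in annulus n, F (‖x‖⁻¹ • x) ∂(stdGaussian (EuclideanSpace ℝ (Fin n))) =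
      (∫⁻ θ : Metric.sphere (0 : EuclideanSpace ℝ (Fin n)) 1, F θ ∂(volume.toSphere)) * κ := by
    rw [← lintegral_indicator (measurableSet_annulus n), stdGaussian_eq_withDensity,
      lintegral_withDensity_eq_lintegral_mul _ (by fun_prop)
        ((by fun_prop : Measurable fun x : EuclideanSpace ℝ (Fin n) ↦ F (‖x‖⁻¹ • x)).indicator
          (measurableSet_annulus n))]
    have e := lintegral_polar hF hh
    rw [finrank_euclideanSpace_fin] at e
    rw [← e]
    refine lintegral_congr fun x ↦ ?_
    simp only [Pi.mul_apply, finrank_euclideanSpace_fin, h]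
    by_cases hx : x ∈ annulus n
    · have hx' : ‖x‖ ∈ Set.Icc (√n / 2) (4 * √n) := hx
      rw [Set.indicator_of_mem hx, Set.indicator_of_mem hx', one_mul, mul_comm]
    · have hx' : ‖x‖ ∉ Set.Icc (√n / 2) (4 * √n) := hx
      rw [Set.indicator_of_notMem hx, Set.indicator_of_notMem hx']
      simp
  rw [polar hF, sphereMeasure, lintegral_smul_measure]
  set S := (volume : Measure (EuclideanSpace ℝ (Fin n))).toSphere Set.univ with hS
  have hS0 : S ≠ 0 := by
    rw [hS, ne_eq, Measure.measure_univ_eq_zero]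
    exact Measure.toSphere_ne_zero _
  have hSt : S ≠ ∞ := measure_ne_top _ _
  -- The polar identity for the constant function 1 says that `S * κ` is the Gaussian mass of the
  -- annulus.
  have h1 : 8⁻¹ ≤ S * κ := by
    have e := polar (F := fun _ ↦ 1) measurable_const
    simp only [lintegral_one, Measure.restrict_apply MeasurableSet.univ, Set.univ_inter] at e
    rw [hS, ← e]
    have h8 := one_eighth_le_stdGaussian_annulus (E := EuclideanSpace ℝ (Fin n)) (by simpa using hn)
    rw [finrank_euclideanSpace_fin] at h8
    have := (ENNReal.le_ofReal_iff_toReal_le (a := 8⁻¹) (by simp) (by positivity)).2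
      (by simpa using h8)
    rwa [ofReal_measureReal] at this
  have h2 : S⁻¹ ≤ 8 * κ := by
    calc S⁻¹ = S⁻¹ * (8 * 8⁻¹) := by rw [ENNReal.mul_inv_cancel (by simp) (by simp), mul_one]
      _ ≤ S⁻¹ * (8 * (S * κ)) := by gcongr
      _ = (S⁻¹ * S) * (8 * κ) := by ring
      _ = 8 * κ := by rw [ENNReal.inv_mul_cancel hS0 hSt, one_mul]
  calc S⁻¹ • ∫⁻ θ : Metric.sphere (0 : EuclideanSpace ℝ (Fin n)) 1, F θ ∂(volume.toSphere)
      ≤ (8 * κ) * ∫⁻ θ : Metric.sphere (0 : EuclideanSpace ℝ (Fin n)) 1, F θ ∂(volume.toSphere) := by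
        rw [smul_eq_mul]; gcongr
    _ = _ := by ring

/-- Hölder's inequality against the constant 1. -/
lemma lintegral_pow_le {α : Type*} [MeasurableSpace α] (m : Measure α) {f : α → ℝ≥0∞}
    (hf : AEMeasurable f m) (k : ℕ) :
    (∫⁻ a, f a ∂m) ^ (k + 1) ≤ m Set.univ ^ k * ∫⁻ a, f a ^ (k + 1) ∂m := by
  rcases Nat.eq_zero_or_pos k with rfl | hk
  · simp
  have hk1 : (1 : ℝ) < (k + 1 : ℕ) := by exact_mod_cast Nat.lt_add_of_pos_left hk
  have hpq := Real.HolderConjugate.conjExponent hk1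
  have h := ENNReal.lintegral_mul_le_Lp_mul_Lq m hpq hf (g := fun _ ↦ 1) aemeasurable_const
  simp only [Pi.mul_apply, mul_one, ENNReal.one_rpow, lintegral_one, ENNReal.rpow_natCast] at h
  have hpow := pow_le_pow_left₀ (by simp) h (k + 1)
  refine hpow.trans (le_of_eq ?_)
  rw [mul_pow, mul_comm, ← ENNReal.rpow_natCast, ← ENNReal.rpow_natCast, ← ENNReal.rpow_mul,
    ← ENNReal.rpow_mul, ← ENNReal.rpow_natCast]
  have hk0 : ((k + 1 : ℕ) : ℝ) ≠ 0 := by positivity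
  have hk0' : (k : ℝ) ≠ 0 := by positivity
  congr 2
  · rw [Real.conjExponent]
    push_cast
    field_simp
    simp
  · rw [one_div, inv_mul_cancel₀ hk0, ENNReal.rpow_one]

/-- For each `x` in the annulus, substitute `u = (‖x‖/√n) t`, so that the unit vector `x/‖x‖` is
replaced by `x/√n`. The Jacobian is at most 4, whence `32 = 8 · 4`. -/
lemma lintegral_line_le {n : ℕ} (hn : 0 < n) {Ψ : EuclideanSpace ℝ (Fin n) → ℝ≥0∞}
    (hΨ : Measurable Ψ) :
    ∫⁻ θ, (∫⁻ u : ℝ, Ψ (u • (θ : EuclideanSpace ℝ (Fin n)))) ∂(sphereMeasure n) ≤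
      32 * ∫⁻ t : ℝ, ∫⁻ x in annulus n, Ψ ((t / √n) • x)
        ∂(stdGaussian (EuclideanSpace ℝ (Fin n))) := by
  have hm : Measurable fun v : EuclideanSpace ℝ (Fin n) ↦ ∫⁻ u : ℝ, Ψ (u • v) :=
    Measurable.lintegral_prod_right' (f := fun p : EuclideanSpace ℝ (Fin n) × ℝ ↦ Ψ (p.2 • p.1))
      (by fun_prop)
  have hs : 0 < √(n : ℝ) := Real.sqrt_pos.2 (by exact_mod_cast hn)
  refine (lintegral_sphereMeasure_le hn hm).trans ?_
  rw [lintegral_lintegral_swap (f := fun (t : ℝ) (x : EuclideanSpace ℝ (Fin n)) ↦ Ψ ((t / √n) • x))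
    (by fun_prop), show (32 : ℝ≥0∞) = 8 * 4 by norm_num, mul_assoc,
    ← lintegral_const_mul' 4 _ (by simp)]
  gcongr 8 * ?_
  refine setLIntegral_mono' (measurableSet_annulus n) fun x hx ↦ ?_
  have hx0 : 0 < ‖x‖ := lt_of_lt_of_le (by positivity) hx.1
  have ha : ‖x‖ / √n ≠ 0 := by positivity
  have e : ∫⁻ u : ℝ, Ψ (u • ‖x‖⁻¹ • x) =
      ENNReal.ofReal (‖x‖ / √n) * ∫⁻ t : ℝ, Ψ ((t / √n) • x) := by
    conv_lhs => rw [← Real.smul_map_volume_mul_left ha]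
    rw [lintegral_smul_measure, lintegral_map (by fun_prop) (by fun_prop), abs_of_pos (by positivity),
      smul_eq_mul]
    congr 1
    refine lintegral_congr fun t ↦ ?_
    rw [smul_smul]
    congr 2
    field_simp
  rw [e]
  gcongr
  refine ENNReal.ofReal_le_of_le_toReal ?_
  rw [div_le_iff₀ hs]
  simpa using hx.2

/-! ### Concentration of smooth functions under the Gaussian measure. -/

/-- The arc `cos s • p.1 + sin s • p.2` joins `p.1` to `p.2`, and its position and velocity are the
two components of the rotation of `p` by `s`. -/
lemma enorm_sub_le_lintegral_rotation {E F : Type*} [NormedAddCommGroup E] [InnerProductSpace ℝ E]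
    [NormedAddCommGroup F] [NormedSpace ℝ F] [CompleteSpace F] {u : E → F} (hu : ContDiff ℝ 1 u) (p : E × E) :
    ‖u p.1 - u p.2‖ₑ ≤ ∫⁻ s in Set.Ioc 0 (Real.pi / 2),
      ‖fderiv ℝ u (ContinuousLinearMap.rotation s p).1 (ContinuousLinearMap.rotation s p).2‖ₑ := by
  have hd : ∀ s : ℝ, HasDerivAt (fun s : ℝ ↦ u (Real.cos s • p.1 + Real.sin s • p.2))
      (fderiv ℝ u (ContinuousLinearMap.rotation s p).1 (ContinuousLinearMap.rotation s p).2) s := by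
    intro s
    have h1 : HasDerivAt (fun s : ℝ ↦ Real.cos s • p.1 + Real.sin s • p.2)
        (-Real.sin s • p.1 + Real.cos s • p.2) s :=
      ((Real.hasDerivAt_cos s).smul_const _).add ((Real.hasDerivAt_sin s).smul_const _)
    exact ((hu.differentiable one_ne_zero _).hasFDerivAt).comp_hasDerivAt s h1
  have hc : Continuous fun s : ℝ ↦ fderiv ℝ u (ContinuousLinearMap.rotation s p).1
      (ContinuousLinearMap.rotation s p).2 := by
    simp only [ContinuousLinearMap.rotation_apply]
    have := hu.continuous_fderiv one_ne_zero
    fun_prop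
  have h := intervalIntegral.integral_eq_sub_of_hasDerivAt (a := 0) (b := Real.pi / 2)
    (fun s _ ↦ hd s) (hc.intervalIntegrable _ _)
  simp only [Real.cos_zero, Real.sin_zero, Real.cos_pi_div_two, Real.sin_pi_div_two, one_smul,
    zero_smul, zero_add, add_zero] at h
  rw [← enorm_neg, neg_sub, ← h, intervalIntegral.integral_of_le (by positivity)]
  exact enorm_integral_le_lintegral_enorm _

section

variable {E : Type*} [NormedAddCommGroup E] [InnerProductSpace ℝ E] [FiniteDimensional ℝ E]
  [MeasurableSpace E] [BorelSpace E]
  {F : Type*} [NormedAddCommGroup F] [NormedSpace ℝ F] [CompleteSpace F]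

/-- Rotation argument of Maurey and Pisier for sixth moments. -/
lemma lintegral_enorm_sub_pow_six_le {u : E → F} (hu : ContDiff ℝ 1 u) :
    ∫⁻ x, ∫⁻ y, ‖u x - u y‖ₑ ^ 6 ∂(stdGaussian E) ∂(stdGaussian E) ≤
      ENNReal.ofReal (Real.pi / 2) ^ 6 *
        ∫⁻ x, ∫⁻ y, ‖fderiv ℝ u x y‖ₑ ^ 6 ∂(stdGaussian E) ∂(stdGaussian E) := by
  set γ := stdGaussian E
  have hcu := hu.continuous
  have hcd := hu.continuous_fderiv one_ne_zero
  have hc1 : Continuous fun p : E × E ↦ ‖u p.1 - u p.2‖ₑ ^ 6 := by fun_prop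
  have hc2 : Continuous fun p : E × E ↦ ‖fderiv ℝ u p.1 p.2‖ₑ ^ 6 := by fun_prop
  have hc3 : Continuous fun q : (E × E) × ℝ ↦
      ‖fderiv ℝ u (ContinuousLinearMap.rotation q.2 q.1).1
        (ContinuousLinearMap.rotation q.2 q.1).2‖ₑ ^ 6 := by
    simp only [ContinuousLinearMap.rotation_apply]
    fun_prop
  -- Rotations preserve `γ.prod γ`, so position and velocity on the arc are again independent
  -- standard Gaussians, and the integrand below does not depend on `s`.
  have hrot (s : ℝ) := IsGaussian.map_rotation_eq_self (μ := γ)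
    (by simp [γ]) s
  rw [← lintegral_prod (fun p : E × E ↦ ‖u p.1 - u p.2‖ₑ ^ 6) hc1.measurable.aemeasurable,
    ← lintegral_prod (fun p : E × E ↦ ‖fderiv ℝ u p.1 p.2‖ₑ ^ 6) hc2.measurable.aemeasurable]
  calc ∫⁻ p, ‖u p.1 - u p.2‖ₑ ^ 6 ∂(γ.prod γ)
      ≤ ∫⁻ p, (ENNReal.ofReal (Real.pi / 2) ^ 5 * ∫⁻ s in Set.Ioc 0 (Real.pi / 2),
          ‖fderiv ℝ u (ContinuousLinearMap.rotation s p).1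
            (ContinuousLinearMap.rotation s p).2‖ₑ ^ 6) ∂(γ.prod γ) := by
        refine lintegral_mono fun p ↦ ?_
        have hm : Continuous fun s : ℝ ↦ ‖fderiv ℝ u (ContinuousLinearMap.rotation s p).1
            (ContinuousLinearMap.rotation s p).2‖ₑ := by
          simp only [ContinuousLinearMap.rotation_apply]
          fun_prop
        have h := lintegral_pow_le (volume.restrict (Set.Ioc 0 (Real.pi / 2)))
          hm.measurable.aemeasurable 5
        refine (pow_le_pow_left₀ (by simp) (enorm_sub_le_lintegral_rotation hu p) 6).trans ?_
        simpa using h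
    _ = ENNReal.ofReal (Real.pi / 2) ^ 5 * ∫⁻ s in Set.Ioc 0 (Real.pi / 2), ∫⁻ p,
          ‖fderiv ℝ u (ContinuousLinearMap.rotation s p).1
            (ContinuousLinearMap.rotation s p).2‖ₑ ^ 6 ∂(γ.prod γ) := by
        rw [lintegral_const_mul' _ _ (by simp), lintegral_lintegral_swap]
        exact hc3.measurable.aemeasurable
    _ = ENNReal.ofReal (Real.pi / 2) ^ 5 * ∫⁻ s in Set.Ioc 0 (Real.pi / 2), ∫⁻ p,
          ‖fderiv ℝ u p.1 p.2‖ₑ ^ 6 ∂(γ.prod γ) := by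
        congr 1
        refine lintegral_congr fun s ↦ ?_
        conv_rhs => rw [← hrot s]
        rw [lintegral_map hc2.measurable (by fun_prop)]
    _ = ENNReal.ofReal (Real.pi / 2) ^ 6 * ∫⁻ p,
          ‖fderiv ℝ u p.1 p.2‖ₑ ^ 6 ∂(γ.prod γ) := by
        rw [lintegral_const]
        simp
        ring

lemma lintegral_enorm_sub_integral_pow_six_le {u : E → F} (hu : ContDiff ℝ 1 u)
    (hi : Integrable u (stdGaussian E)) :
    ∫⁻ x, ‖u x - ∫ y, u y ∂(stdGaussian E)‖ₑ ^ 6 ∂(stdGaussian E) ≤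
      ENNReal.ofReal (Real.pi / 2) ^ 6 *
        ∫⁻ x, ∫⁻ y, ‖fderiv ℝ u x y‖ₑ ^ 6 ∂(stdGaussian E) ∂(stdGaussian E) := by
  refine le_trans (lintegral_mono fun x ↦ ?_) (lintegral_enorm_sub_pow_six_le hu)
  have hcu := hu.continuous
  have e : u x - ∫ y, u y ∂(stdGaussian E) = ∫ y, (u x - u y) ∂(stdGaussian E) := by
    rw [integral_sub (integrable_const _) hi]
    simp
  rw [e]
  refine (pow_le_pow_left₀ (by simp) (enorm_integral_le_lintegral_enorm _) 6).trans ?_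
  have hm : Continuous fun y ↦ ‖u x - u y‖ₑ := by fun_prop
  simpa using lintegral_pow_le (stdGaussian E) hm.measurable.aemeasurable 5

end

/-! ### Plancherel's theorem and the `L²`-distance of distribution functions. -/

open FourierTransform in
/-- **Plancherel's theorem** for functions in `L¹ ∩ L²`. -/
lemma lintegral_enorm_fourier_sq {f : ℝ → ℂ} (hf1 : Integrable f) (hf2 : MemLp f 2) :
    ∫⁻ w, ‖𝓕 f w‖ₑ ^ 2 = ∫⁻ x, ‖f x‖ₑ ^ 2 := by
  have hcont : Continuous (𝓕 f) :=
    VectorFourier.fourierIntegral_continuous Real.continuous_fourierChar continuous_inner hf1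
  set fL := hf2.toLp f
  -- The Fourier transform on `L²` is identified with the integral formula by testing against smooth
  -- compactly supported `g` and moving the transform onto `g` on both sides.
  have hae : ∀ᵐ w, (𝓕 fL : Lp ℂ 2 (volume : Measure ℝ)) w = 𝓕 f w := by
    apply ae_eq_of_integral_contDiff_smul_eq
    · exact (Lp.memLp _).locallyIntegrable (by norm_num)
    · exact hcont.locallyIntegrable
    · intro g g_smooth g_cpt
      have hg₁ : HasCompactSupport (Complex.ofRealCLM ∘ g) := g_cpt.comp_left rfl
      have hg₂ : ContDiff ℝ (↑(⊤ : ℕ∞)) (Complex.ofRealCLM ∘ g) := by fun_prop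
      have h := DFunLike.congr_fun (Lp.fourier_toTemperedDistribution_eq fL)
        (hg₁.toSchwartzMap hg₂)
      rw [TemperedDistribution.fourier_apply, Lp.toTemperedDistribution_apply,
        Lp.toTemperedDistribution_apply] at h
      have h1 : ∫ x, g x • (𝓕 fL : Lp ℂ 2 (volume : Measure ℝ)) x =
          ∫ x, (hg₁.toSchwartzMap hg₂) x • (𝓕 fL : Lp ℂ 2 (volume : Measure ℝ)) x := by simp
      rw [h1, ← h]
      have h2 : ∫ x, (𝓕 (hg₁.toSchwartzMap hg₂)) x • fL x =
          ∫ x, (𝓕 (hg₁.toSchwartzMap hg₂)) x • f x := by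
        refine integral_congr_ae ?_
        filter_upwards [hf2.coeFn_toLp] with x hx
        rw [hx]
      rw [h2, SchwartzMap.fourier_coe]
      have h3 := VectorFourier.integral_fourierIntegral_smul_eq_flip (L := innerₗ ℝ)
        (μ := volume) (ν := volume) (e := Real.fourierChar)
        Real.continuous_fourierChar continuous_inner
        (hg₁.toSchwartzMap hg₂).integrable hf1
      rw [flip_innerₗ] at h3
      refine h3.trans ?_
      simp
      rfl
  have hn := Lp.norm_fourier_eq fL
  have h2 : eLpNorm (𝓕 f) 2 = eLpNorm f 2 := by
    rw [← eLpNorm_congr_ae hae, ← Lp.enorm_def, ← eLpNorm_congr_ae hf2.coeFn_toLp, ← Lp.enorm_def,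
      ← ofReal_norm, ← ofReal_norm, hn]
  rw [eLpNorm_eq_lintegral_rpow_enorm_toReal (by norm_num) (by norm_num),
    eLpNorm_eq_lintegral_rpow_enorm_toReal (by norm_num) (by norm_num)] at h2
  have := ENNReal.rpow_left_injective (x := 1 / (2 : ℝ≥0∞).toReal) (by norm_num) h2
  simpa using this

/-- The difference of the indicators of `[y, ∞)` and `[0, ∞)`. -/
def stepDiff (y x : ℝ) : ℝ :=
  (Set.Ici y).indicator (fun _ ↦ 1) x - (Set.Ici 0).indicator (fun _ ↦ 1) x

lemma stepDiff_of_nonpos {y : ℝ} (hy : y ≤ 0) (x : ℝ) :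
    stepDiff y x = (Set.Ico y 0).indicator (fun _ ↦ 1) x := by
  simp only [stepDiff, Set.indicator, Set.mem_Ici, Set.mem_Ico]
  split_ifs <;> grind

lemma stepDiff_of_nonneg {y : ℝ} (hy : 0 ≤ y) (x : ℝ) :
    stepDiff y x = -(Set.Ico 0 y).indicator (fun _ ↦ 1) x := by
  simp only [stepDiff, Set.indicator, Set.mem_Ici, Set.mem_Ico]
  split_ifs <;> grind

lemma measurable_stepDiff : Measurable fun p : ℝ × ℝ ↦ stepDiff p.1 p.2 := by
  have h1 : MeasurableSet {p : ℝ × ℝ | p.1 ≤ p.2} := measurableSet_le measurable_fst measurable_snd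
  have h2 : MeasurableSet {p : ℝ × ℝ | 0 ≤ p.2} := measurableSet_le measurable_const measurable_snd
  exact ((measurable_const (a := (1 : ℝ))).indicator h1).sub
    ((measurable_const (a := (1 : ℝ))).indicator h2)

lemma integral_stepDiff_smul (y : ℝ) (g : ℝ → ℂ) :
    ∫ x, stepDiff y x • g x = ∫ x in y..0, g x := by
  have e (s : Set ℝ) (x : ℝ) : s.indicator (fun _ ↦ (1 : ℝ)) x • g x = s.indicator g x := by
    by_cases h : x ∈ s <;> simp [h]
  rcases le_total y 0 with hy | hy
  · simp_rw [stepDiff_of_nonpos hy, e]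
    rw [integral_indicator measurableSet_Ico, intervalIntegral.integral_of_le hy,
      integral_Ico_eq_integral_Ioo, integral_Ioc_eq_integral_Ioo]
  · simp_rw [stepDiff_of_nonneg hy, neg_smul, e]
    rw [integral_neg, integral_indicator measurableSet_Ico, intervalIntegral.integral_of_ge hy,
      integral_Ico_eq_integral_Ioo, integral_Ioc_eq_integral_Ioo]

lemma lintegral_enorm_stepDiff (y : ℝ) : ∫⁻ x, ‖stepDiff y x‖ₑ = ‖y‖ₑ := by
  have e (s : Set ℝ) (x : ℝ) : ‖s.indicator (fun _ ↦ (1 : ℝ)) x‖ₑ =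
      s.indicator (fun _ ↦ (1 : ℝ≥0∞)) x := by
    by_cases h : x ∈ s <;> simp [h]
  rcases le_total y 0 with hy | hy
  · simp_rw [stepDiff_of_nonpos hy, e]
    rw [lintegral_indicator_const measurableSet_Ico, Real.volume_Ico, one_mul, zero_sub,
      ← ofReal_norm, Real.norm_eq_abs, abs_of_nonpos hy]
  · simp_rw [stepDiff_of_nonneg hy, enorm_neg, e]
    rw [lintegral_indicator_const measurableSet_Ico, Real.volume_Ico, one_mul, sub_zero,
      ← ofReal_norm, Real.norm_eq_abs, abs_of_nonneg hy]

lemma integrable_stepDiff_prod {α : Measure ℝ} [IsProbabilityMeasure α]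
    (hα : Integrable id α) :
    Integrable (fun p : ℝ × ℝ ↦ stepDiff p.1 p.2) (α.prod volume) := by
  refine ⟨measurable_stepDiff.aestronglyMeasurable, ?_⟩
  rw [HasFiniteIntegral, lintegral_prod _ measurable_stepDiff.enorm.aemeasurable]
  simp_rw [lintegral_enorm_stepDiff]
  exact hα.2

/-- A distribution function is not integrable on `ℝ`. Subtracting the step at 0 makes it an average
of the compactly supported functions `stepDiff y`, to which Fubini's theorem applies when the first
moment is finite. The step cancels in differences of distribution functions. -/
lemma integral_stepDiff_left {α : Measure ℝ} [IsProbabilityMeasure α] (x : ℝ) :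
    ∫ y, stepDiff y x ∂α = cdf α x - (Set.Ici 0).indicator (fun _ ↦ 1) x := by
  have e : (fun y : ℝ ↦ (Set.Ici y).indicator (fun _ ↦ (1 : ℝ)) x) =
      (Set.Iic x).indicator fun _ ↦ 1 := by
    ext y
    simp [Set.indicator]
  have hi : Integrable (fun y : ℝ ↦ (Set.Ici y).indicator (fun _ ↦ (1 : ℝ)) x) α := by
    rw [e]
    exact (integrable_const _).indicator measurableSet_Iic
  simp only [stepDiff]
  rw [integral_sub hi (integrable_const _), e, integral_indicator_const _ measurableSet_Iic,
    cdf_eq_real]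
  simp

lemma integrable_cdf_sub_indicator {α : Measure ℝ} [IsProbabilityMeasure α]
    (hα : Integrable id α) :
    Integrable (fun x ↦ cdf α x - (Set.Ici 0).indicator (fun _ ↦ 1) x) := by
  simpa only [integral_stepDiff_left] using (integrable_stepDiff_prod hα).integral_prod_right

/-- By Fubini's theorem it suffices to transform `stepDiff y`, where the integral of the exponential
over the interval between `y` and 0 is explicit. -/
lemma integral_cdf_sub_indicator_mul_exp {α : Measure ℝ} [IsProbabilityMeasure α]
    (hα : Integrable id α) {t : ℝ} (ht : t ≠ 0) :
    ∫ x, (cdf α x - (Set.Ici 0).indicator (fun _ ↦ 1) x) • Complex.exp (t * x * Complex.I) =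
      (1 - charFun α t) / (t * Complex.I) := by
  have hti : (t * Complex.I : ℂ) ≠ 0 := by simp [ht]
  have hint : Integrable (fun p : ℝ × ℝ ↦ stepDiff p.1 p.2 • Complex.exp (t * p.2 * Complex.I))
      (α.prod volume) := by
    refine (integrable_stepDiff_prod hα).norm.mono'
      (measurable_stepDiff.smul (by fun_prop)).aestronglyMeasurable
      (Filter.Eventually.of_forall fun p ↦ ?_)
    rw [norm_smul]
    have : ‖Complex.exp (t * p.2 * Complex.I)‖ = 1 := by
      exact_mod_cast Complex.norm_exp_ofReal_mul_I (t * p.2)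
    rw [this, mul_one]
  have hexp : Integrable (fun x : ℝ ↦ Complex.exp (t * x * Complex.I)) α := by
    refine (integrable_const (1 : ℝ)).mono' (by fun_prop) (Filter.Eventually.of_forall fun x ↦ ?_)
    exact_mod_cast (Complex.norm_exp_ofReal_mul_I (t * x)).le
  calc ∫ x, (cdf α x - (Set.Ici 0).indicator (fun _ ↦ 1) x) • Complex.exp (t * x * Complex.I)
      = ∫ x, ∫ y, stepDiff y x • Complex.exp (t * x * Complex.I) ∂α := by
        simp_rw [integral_smul_const, integral_stepDiff_left]
    _ = ∫ y, (∫ x, stepDiff y x • Complex.exp (t * x * Complex.I)) ∂α :=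
        (integral_integral_swap hint).symm
    _ = ∫ y, (1 - Complex.exp (t * y * Complex.I)) / (t * Complex.I) ∂α := by
        refine integral_congr_ae (Filter.Eventually.of_forall fun y ↦ ?_)
        simp only
        rw [integral_stepDiff_smul]
        have e (x : ℝ) : Complex.exp (t * x * Complex.I) = Complex.exp ((t * Complex.I) * x) := by
          ring_nf
        simp_rw [e]
        rw [integral_exp_mul_complex hti]
        simp
    _ = (1 - charFun α t) / (t * Complex.I) := by
        rw [integral_div, integral_sub (integrable_const _) hexp, charFun_apply_real]
        simp

lemma integrable_cdf_sub_cdf {α β : Measure ℝ} [IsProbabilityMeasure α] [IsProbabilityMeasure β]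
    (hα : Integrable id α) (hβ : Integrable id β) :
    Integrable (fun x ↦ cdf α x - cdf β x) := by
  refine ((integrable_cdf_sub_indicator hα).sub (integrable_cdf_sub_indicator hβ)).congr
    (Filter.Eventually.of_forall fun x ↦ ?_)
  simp

open FourierTransform in
lemma fourier_cdf_sub_cdf {α β : Measure ℝ} [IsProbabilityMeasure α] [IsProbabilityMeasure β]
    (hα : Integrable id α) (hβ : Integrable id β) {w : ℝ} (hw : w ≠ 0) :
    𝓕 (fun x ↦ ((cdf α x - cdf β x : ℝ) : ℂ)) w =
      (charFun β (-(2 * Real.pi) * w) - charFun α (-(2 * Real.pi) * w)) /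
        ((-(2 * Real.pi) * w : ℝ) * Complex.I) := by
  have ht : -(2 * Real.pi) * w ≠ 0 := by simp [hw, Real.pi_ne_zero]
  have hb {α : Measure ℝ} [IsProbabilityMeasure α] (hα : Integrable id α) (t : ℝ) :
      Integrable fun x : ℝ ↦ (cdf α x - (Set.Ici 0).indicator (fun _ ↦ 1) x) •
        Complex.exp (t * x * Complex.I) := by
    refine (integrable_cdf_sub_indicator hα).norm.mono'
      ((integrable_cdf_sub_indicator hα).1.smul (by fun_prop))
      (Filter.Eventually.of_forall fun x ↦ ?_)
    rw [norm_smul]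
    have : ‖Complex.exp (t * x * Complex.I)‖ = 1 := by
      exact_mod_cast Complex.norm_exp_ofReal_mul_I (t * x)
    rw [this, mul_one]
  have h := congrArg₂ (· - ·) (integral_cdf_sub_indicator_mul_exp hα ht)
    (integral_cdf_sub_indicator_mul_exp hβ ht)
  rw [← integral_sub (hb hα _) (hb hβ _)] at h
  rw [Real.fourier_real_eq_integral_exp_smul]
  refine Eq.trans (integral_congr_ae (Filter.Eventually.of_forall fun x ↦ ?_))
    (h.trans (by rw [← sub_div]; congr 1; ring))
  simp only [Complex.real_smul, smul_eq_mul]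
  push_cast
  ring_nf

/-- The `L²`-distance between two distribution functions in terms of characteristic functions. -/
lemma lintegral_cdf_sub_cdf_sq {α β : Measure ℝ} [IsProbabilityMeasure α] [IsProbabilityMeasure β]
    (hα : Integrable id α) (hβ : Integrable id β) :
    ENNReal.ofReal (2 * Real.pi) * ∫⁻ x, ENNReal.ofReal ((cdf α x - cdf β x) ^ 2) =
      ∫⁻ t, (‖charFun α t - charFun β t‖ₑ / ‖t‖ₑ) ^ 2 := by
  have hH := integrable_cdf_sub_cdf hα hβ
  have hHc : Integrable fun x ↦ ((cdf α x - cdf β x : ℝ) : ℂ) := hH.ofReal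
  have hf2 : MemLp (fun x ↦ ((cdf α x - cdf β x : ℝ) : ℂ)) 2 := by
    have hb : ∀ x, |cdf α x - cdf β x| ≤ 1 := fun x ↦ by
      rw [abs_le]
      constructor <;> linarith [cdf_nonneg α x, cdf_le_one α x, cdf_nonneg β x, cdf_le_one β x]
    rw [memLp_two_iff_integrable_sq_norm hHc.1]
    refine hH.norm.mono' (hHc.1.norm.pow 2) (Filter.Eventually.of_forall fun x ↦ ?_)
    simp only [Complex.norm_real, norm_pow, Real.norm_eq_abs, abs_abs]
    nlinarith [hb x, abs_nonneg (cdf α x - cdf β x)]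
  have h := lintegral_enorm_fourier_sq hHc hf2
  have e1 : ∫⁻ x, ‖((cdf α x - cdf β x : ℝ) : ℂ)‖ₑ ^ 2 =
      ∫⁻ x, ENNReal.ofReal ((cdf α x - cdf β x) ^ 2) := by
    refine lintegral_congr fun x ↦ ?_
    rw [← ofReal_norm, ← ENNReal.ofReal_pow (norm_nonneg _), Complex.norm_real, Real.norm_eq_abs,
      sq_abs]
  rw [← e1]
  refine (congrArg _ h.symm).trans ?_
  have hpi : -(2 * Real.pi) ≠ 0 := by simp [Real.pi_ne_zero]
  have hm : Measurable fun t : ℝ ↦ (‖charFun α t - charFun β t‖ₑ / ‖t‖ₑ) ^ 2 := by fun_prop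
  -- The substitution `t = -2πw` between the two normalisations of the Fourier transform produces
  -- the factor `2π`.
  conv_rhs => rw [← Real.smul_map_volume_mul_left hpi]
  rw [lintegral_smul_measure, lintegral_map hm (by fun_prop), abs_neg,
    abs_of_pos (by positivity), smul_eq_mul]
  congr 1
  refine lintegral_congr_ae ?_
  filter_upwards [compl_mem_ae_iff.2 (measure_singleton (0 : ℝ))] with w hw
  rw [fourier_cdf_sub_cdf hα hβ hw, ← enorm_neg (charFun α _ - _), neg_sub]
  have hw' : -(2 * Real.pi) * w ≠ 0 := mul_ne_zero hpi hw
  rw [← ofReal_norm, ← ofReal_norm, ← ofReal_norm, ← ENNReal.ofReal_div_of_pos (by simpa using hw'),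
    norm_div]
  simp

/-! ### Elementary estimates for characteristic functions. -/

/-- The derivative is bounded by 1, because `|u| ≤ 1 + u²/2 ≤ e^{u²/2}`. -/
lemma abs_exp_neg_sq_sub_le (a b : ℝ) :
    |Real.exp (-(a ^ 2 / 2)) - Real.exp (-(b ^ 2 / 2))| ≤ |a - b| := by
  have hd : ∀ u : ℝ, HasDerivAt (fun u : ℝ ↦ Real.exp (-(u ^ 2 / 2)))
      (Real.exp (-(u ^ 2 / 2)) * -u) u := by
    intro u
    have h : HasDerivAt (fun u : ℝ ↦ -(u ^ 2 / 2)) (-u) u := by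
      refine (((hasDerivAt_pow 2 u).div_const 2).neg).congr_deriv ?_
      norm_num
    exact h.exp
  have hb : ∀ u ∈ (Set.univ : Set ℝ), ‖Real.exp (-(u ^ 2 / 2)) * -u‖ ≤ 1 := by
    intro u _
    rw [norm_mul, norm_neg, Real.norm_eq_abs, Real.norm_eq_abs, abs_of_pos (Real.exp_pos _),
      Real.exp_neg, inv_mul_le_iff₀ (Real.exp_pos _), mul_one]
    have := Real.add_one_le_exp (u ^ 2 / 2)
    nlinarith [sq_nonneg (|u| - 1), sq_abs u]
  have h := Convex.norm_image_sub_le_of_norm_hasDerivWithin_le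
    (fun u _ ↦ (hd u).hasDerivWithinAt) hb convex_univ (Set.mem_univ b) (Set.mem_univ a)
  simpa using h

lemma sq_integral_abs_le {α : Type*} [MeasurableSpace α] {m : Measure α} [IsProbabilityMeasure m]
    {f : α → ℝ} (hf : MemLp f 2 m) : (∫ x, |f x| ∂m) ^ 2 ≤ ∫ x, f x ^ 2 ∂m := by
  have hv := variance_nonneg (fun x ↦ |f x|) m
  have ha : MemLp (fun x ↦ |f x|) 2 m := hf.abs
  rw [variance_eq_sub ha] at hv
  simp only [Pi.pow_apply, sq_abs] at hv
  linarith

section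

variable {E : Type*} [NormedAddCommGroup E] [InnerProductSpace ℝ E] [FiniteDimensional ℝ E]
  [MeasurableSpace E] [BorelSpace E]

lemma lintegral_enorm_dual_pow_six_le (L : E →L[ℝ] ℝ) :
    ∫⁻ y, ‖L y‖ₑ ^ 6 ∂(stdGaussian E) ≤ ENNReal.ofReal (1440 * ‖L‖ ^ 6) := by
  have h := lintegral_inner_pow_six_stdGaussian_le ((InnerProductSpace.toDual ℝ E).symm L)
  rw [LinearIsometryEquiv.norm_map] at h
  refine le_trans (le_of_eq (lintegral_congr fun y ↦ ?_)) h
  rw [InnerProductSpace.toDual_symm_apply, ← ofReal_norm, ← ENNReal.ofReal_pow (norm_nonneg _),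
    Real.norm_eq_abs, Even.pow_abs (by decide)]

/-- Split into real and imaginary parts with `(a² + b²)³ ≤ 4(a⁶ + b⁶)`; hence `11520 = 4 · 2 ·
1440`. -/
lemma lintegral_enorm_clm_pow_six_le (L : E →L[ℝ] ℂ) :
    ∫⁻ y, ‖L y‖ₑ ^ 6 ∂(stdGaussian E) ≤ ENNReal.ofReal (11520 * ‖L‖ ^ 6) := by
  have h1 := lintegral_enorm_dual_pow_six_le (Complex.reCLM ∘L L)
  have h2 := lintegral_enorm_dual_pow_six_le (Complex.imCLM ∘L L)
  have n1 : ‖Complex.reCLM ∘L L‖ ≤ ‖L‖ :=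
    (ContinuousLinearMap.opNorm_comp_le _ _).trans (by simp)
  have n2 : ‖Complex.imCLM ∘L L‖ ≤ ‖L‖ :=
    (ContinuousLinearMap.opNorm_comp_le _ _).trans (by simp)
  have hp : ∀ y, ‖L y‖ₑ ^ 6 ≤ 4 * (‖(Complex.reCLM ∘L L) y‖ₑ ^ 6 + ‖(Complex.imCLM ∘L L) y‖ₑ ^ 6) := by
    intro y
    simp only [← ofReal_norm]
    rw [← ENNReal.ofReal_pow (norm_nonneg _), ← ENNReal.ofReal_pow (norm_nonneg _),
      ← ENNReal.ofReal_pow (norm_nonneg _), ← ENNReal.ofReal_add (by positivity) (by positivity),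
      show (4 : ℝ≥0∞) = ENNReal.ofReal 4 by simp, ← ENNReal.ofReal_mul (by norm_num)]
    apply ENNReal.ofReal_le_ofReal
    have e : ‖L y‖ ^ 2 = (L y).re ^ 2 + (L y).im ^ 2 := by
      rw [← Complex.normSq_eq_norm_sq, Complex.normSq_apply]; ring
    have e6 : ‖L y‖ ^ 6 = ((L y).re ^ 2 + (L y).im ^ 2) ^ 3 := by rw [← e]; ring
    rw [e6]
    simp only [ContinuousLinearMap.comp_apply, Complex.reCLM_apply, Complex.imCLM_apply,
      Real.norm_eq_abs]
    rw [Even.pow_abs (by decide), Even.pow_abs (by decide)]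
    have h1 := sq_nonneg (L y).re
    have h2 := sq_nonneg (L y).im
    generalize (L y).re = a at *
    generalize (L y).im = b at *
    have : 4 * (a ^ 6 + b ^ 6) - (a ^ 2 + b ^ 2) ^ 3 = 3 * (a ^ 2 + b ^ 2) * (a ^ 2 - b ^ 2) ^ 2 := by
      ring
    nlinarith [mul_nonneg (add_nonneg h1 h2) (sq_nonneg (a ^ 2 - b ^ 2))]
  calc ∫⁻ y, ‖L y‖ₑ ^ 6 ∂(stdGaussian E)
      ≤ ∫⁻ y, 4 * (‖(Complex.reCLM ∘L L) y‖ₑ ^ 6 + ‖(Complex.imCLM ∘L L) y‖ₑ ^ 6)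
          ∂(stdGaussian E) := lintegral_mono hp
    _ = 4 * (∫⁻ y, ‖(Complex.reCLM ∘L L) y‖ₑ ^ 6 ∂(stdGaussian E) +
          ∫⁻ y, ‖(Complex.imCLM ∘L L) y‖ₑ ^ 6 ∂(stdGaussian E)) := by
        rw [lintegral_const_mul' _ _ (by simp), lintegral_add_left (by fun_prop)]
    _ ≤ 4 * (ENNReal.ofReal (1440 * ‖L‖ ^ 6) + ENNReal.ofReal (1440 * ‖L‖ ^ 6)) := by
        gcongr
        · exact h1.trans (ENNReal.ofReal_le_ofReal (by gcongr))
        · exact h2.trans (ENNReal.ofReal_le_ofReal (by gcongr))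
    _ = _ := by
        rw [← ENNReal.ofReal_add (by positivity) (by positivity),
          show (4 : ℝ≥0∞) = ENNReal.ofReal 4 by simp, ← ENNReal.ofReal_mul (by norm_num)]
        congr 1
        ring

/-- Fubini's theorem exchanges the roles of the two measures: the average of the characteristic
function of `ν` is an average over `ν` of the explicit Gaussian one. -/
lemma integral_charFun_smul_stdGaussian (ν : Measure E) [IsProbabilityMeasure ν] (c : ℝ) :
    ∫ x, charFun ν (c • x) ∂(stdGaussian E) =
      ((∫ z, Real.exp (-((c * ‖z‖) ^ 2 / 2)) ∂ν : ℝ) : ℂ) := by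
  have hint : Integrable (fun p : E × E ↦ Complex.exp ((⟪p.2, c • p.1⟫ : ℝ) * Complex.I))
      ((stdGaussian E).prod ν) := by
    refine (integrable_const (1 : ℝ)).mono' (by fun_prop) (Filter.Eventually.of_forall fun x ↦ ?_)
    exact (Complex.norm_exp_ofReal_mul_I _).le
  simp_rw [charFun_apply]
  rw [integral_integral_swap hint, ← integral_complex_ofReal]
  refine integral_congr_ae (Filter.Eventually.of_forall fun z ↦ ?_)
  have h := charFun_stdGaussian (c • z)
  rw [charFun_apply] at h
  have e : ∀ x : E, (⟪z, c • x⟫ : ℝ) = ⟪x, c • z⟫ := fun x ↦ by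
    rw [inner_smul_right, inner_smul_right, real_inner_comm]
  simp_rw [e]
  rw [h, norm_smul]
  push_cast
  congr 1
  rw [mul_pow, mul_pow, ← Complex.ofReal_pow, Real.norm_eq_abs, sq_abs]
  push_cast
  ring

/-- The derivative in direction `y` is `i E⟨X, y⟩e^{i⟨X, v⟩}`, at most `(E⟨X, y⟩²)^{1/2} = ‖y‖` by
Cauchy–Schwarz and isotropy. That this bound is free of the dimension is what makes concentration
effective. -/
lemma norm_fderiv_charFun_le {μ : Measure E} [IsProbabilityMeasure μ] (h2 : MemLp id 2 μ)
    (hiso : ∀ v, ∫ x, ⟪v, x⟫ ^ 2 ∂μ = ‖v‖ ^ 2) (v : E) :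
    ‖fderiv ℝ (charFun μ) v‖ ≤ 1 := by
  have h1 : MemLp id (1 : ℕ) μ := h2.mono_exponent (by norm_num)
  refine ContinuousLinearMap.opNorm_le_bound _ zero_le_one fun y ↦ ?_
  have e := iteratedFDeriv_charFun (t := v) h1 (fun _ ↦ y)
  rw [iteratedFDeriv_one_apply] at e
  simp only [Finset.univ_unique, Finset.prod_singleton, pow_one] at e
  rw [e, norm_mul, Complex.norm_I, one_mul, one_mul]
  have hL : MemLp (fun x ↦ ⟪y, x⟫) 2 μ := (innerSL ℝ y).comp_memLp' h2
  calc ‖∫ x, ((⟪x, y⟫ : ℝ) : ℂ) * Complex.exp ((⟪x, v⟫ : ℝ) * Complex.I) ∂μ‖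
      ≤ ∫ x, |⟪y, x⟫| ∂μ := by
        refine (norm_integral_le_integral_norm _).trans (le_of_eq ?_)
        refine integral_congr_ae (Filter.Eventually.of_forall fun x ↦ ?_)
        simp only [norm_mul, Complex.norm_real, Complex.norm_exp_ofReal_mul_I, mul_one,
          Real.norm_eq_abs, real_inner_comm]
    _ ≤ √(∫ x, ⟪y, x⟫ ^ 2 ∂μ) := by
        apply Real.le_sqrt_of_sq_le
        exact sq_integral_abs_le hL
    _ = ‖y‖ := by rw [hiso, Real.sqrt_sq (norm_nonneg _)]

end

/-! ### Sixth moments of the difference of characteristic functions. -/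

/-- Isotropic probability measures on `ℝⁿ`, supported in the ball of radius `b √n` and with
`Var ‖x‖² ≤ σ² n`. -/
structure IsBoundedIsotropic {n : ℕ} (μ : Measure (EuclideanSpace ℝ (Fin n))) (b σ : ℝ) : Prop where
  bound : ∀ᵐ x ∂μ, ‖x‖ ≤ b * √n
  second_moment : ∀ v, ∫ x, ⟪v, x⟫ ^ 2 ∂μ = ‖v‖ ^ 2
  norm_sq : ∫ x, (‖x‖ ^ 2 / n - 1) ^ 2 ∂μ ≤ σ ^ 2 / n
  nonneg : 0 ≤ σ

lemma lintegral_norm_sq_sub_pow_six_le {n : ℕ} :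
    ∫⁻ x, ‖‖x‖ ^ 2 - n‖ₑ ^ 6 ∂(stdGaussian (EuclideanSpace ℝ (Fin n))) ≤
      ENNReal.ofReal (10 ^ 10 * n ^ 3) := by
  have hu : ContDiff ℝ 1 fun x : EuclideanSpace ℝ (Fin n) ↦ ‖x‖ ^ 2 := contDiff_norm_sq ℝ
  have h := lintegral_enorm_sub_integral_pow_six_le hu (integrable_norm_pow_stdGaussian 2)
  rw [integral_norm_sq_stdGaussian, finrank_euclideanSpace_fin] at h
  refine h.trans ?_
  have hx (x : EuclideanSpace ℝ (Fin n)) :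
      ∫⁻ y, ‖fderiv ℝ (fun x : EuclideanSpace ℝ (Fin n) ↦ ‖x‖ ^ 2) x y‖ₑ ^ 6
        ∂(stdGaussian (EuclideanSpace ℝ (Fin n))) ≤ ENNReal.ofReal (1440 * (2 ^ 6 * ‖x‖ ^ 6)) := by
    refine (lintegral_enorm_dual_pow_six_le _).trans (ENNReal.ofReal_le_ofReal ?_)
    rw [fderiv_norm_sq_apply, ← mul_pow]
    gcongr
    rw [← Nat.cast_smul_eq_nsmul ℝ, norm_smul, innerSL_apply_norm]
    simp
  refine (mul_le_mul_right (lintegral_mono hx) _).trans ?_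
  rw [← ofReal_integral_eq_lintegral_ofReal
    (((integrable_norm_pow_stdGaussian 6).const_mul _).const_mul _)
    (Filter.Eventually.of_forall fun x ↦ by positivity), integral_const_mul, integral_const_mul,
    ← ENNReal.ofReal_pow (by positivity), ← ENNReal.ofReal_mul (by positivity)]
  apply ENNReal.ofReal_le_ofReal
  have h6 := integral_norm_pow_stdGaussian_le (E := EuclideanSpace ℝ (Fin n)) 2
  have h6' := integral_pow_six_gaussianReal_le
  norm_num at h6 h6'
  have hpi : (Real.pi / 2) ^ 6 ≤ 1.6 ^ 6 := by
    gcongr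
    linarith [Real.pi_lt_d2]
  have h7 : ∫ x : EuclideanSpace ℝ (Fin n), ‖x‖ ^ 6 ∂(stdGaussian (EuclideanSpace ℝ (Fin n))) ≤
      (n : ℝ) ^ 3 * 1440 := h6.trans (by gcongr)
  have h8 : 0 ≤ ∫ x : EuclideanSpace ℝ (Fin n), ‖x‖ ^ 6
    ∂(stdGaussian (EuclideanSpace ℝ (Fin n))) := integral_nonneg fun x ↦ by positivity
  calc (Real.pi / 2) ^ 6 * (1440 * (2 ^ 6 * ∫ x : EuclideanSpace ℝ (Fin n), ‖x‖ ^ 6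
          ∂(stdGaussian (EuclideanSpace ℝ (Fin n)))))
      ≤ 1.6 ^ 6 * (1440 * (2 ^ 6 * ((n : ℝ) ^ 3 * 1440))) := by gcongr
    _ = (1.6 ^ 6 * 1440 * 2 ^ 6 * 1440) * (n : ℝ) ^ 3 := by ring
    _ ≤ _ := by gcongr; norm_num

lemma abs_div_sqrt_sub_one_le {r a : ℝ} (hr : 0 ≤ r) (ha : 0 ≤ a) :
    |r / √a - 1| ≤ |r ^ 2 / a - 1| := by
  have e : r ^ 2 / a - 1 = (r / √a - 1) * (r / √a + 1) := by
    have : r ^ 2 / a = (r / √a) ^ 2 := by rw [div_pow, Real.sq_sqrt ha]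
    rw [this]
    ring
  have h0 : 0 ≤ r / √a := by positivity
  rw [e, abs_mul]
  apply le_mul_of_one_le_right (abs_nonneg _)
  rw [abs_of_pos (by positivity)]
  linarith

/-- Hölder's inequality for counting measure on three points; `243 = 3⁵`. -/
lemma add_three_pow_six_le (a b c : ℝ≥0∞) :
    (a + b + c) ^ 6 ≤ 243 * (a ^ 6 + b ^ 6 + c ^ 6) := by
  have h := lintegral_pow_le (Measure.count : Measure (Fin 3)) (f := ![a, b, c])
    (by fun_prop) 5
  rw [lintegral_fintype, lintegral_fintype] at h
  simp [Fin.sum_univ_three] at h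
  norm_num at h
  exact h

section

variable {n : ℕ} {μ : Measure (EuclideanSpace ℝ (Fin n))} [IsProbabilityMeasure μ] {b σ : ℝ}

lemma IsBoundedIsotropic.memLp (h : IsBoundedIsotropic μ b σ) : MemLp id 2 μ :=
  MemLp.of_bound (by fun_prop) (b * √n) h.bound

lemma IsBoundedIsotropic.integrable_of_continuous (h : IsBoundedIsotropic μ b σ)
    {f : EuclideanSpace ℝ (Fin n) → ℝ} (hf : Continuous f) : MemLp f 2 μ := by
  obtain ⟨C, hC⟩ := (isCompact_closedBall (0 : EuclideanSpace ℝ (Fin n))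
    (b * √n)).exists_bound_of_continuousOn hf.continuousOn
  refine MemLp.of_bound hf.aestronglyMeasurable C ?_
  filter_upwards [h.bound] with x hx
  exact hC x (by simpa using hx)

lemma IsBoundedIsotropic.abs_integral_exp_sub_le (h : IsBoundedIsotropic μ b σ) (hn : 0 < n)
    (t : ℝ) :
    |∫ z, Real.exp (-((t / √n * ‖z‖) ^ 2 / 2)) ∂μ - Real.exp (-(t ^ 2 / 2))| ≤
      |t| * (σ / √n) := by
  have hs : 0 < √(n : ℝ) := Real.sqrt_pos.2 (by exact_mod_cast hn)
  have hs2 : √(n : ℝ) ^ 2 = n := Real.sq_sqrt (by positivity)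
  have hn0 : (0 : ℝ) < n := by exact_mod_cast hn
  have hi : Integrable (fun z : EuclideanSpace ℝ (Fin n) ↦
      Real.exp (-((t / √n * ‖z‖) ^ 2 / 2))) μ :=
    (h.integrable_of_continuous (by fun_prop)).integrable (by norm_num)
  have hq : MemLp (fun z : EuclideanSpace ℝ (Fin n) ↦ ‖z‖ ^ 2 / n - 1) 2 μ :=
    h.integrable_of_continuous (by fun_prop)
  have e : ∫ z, Real.exp (-((t / √n * ‖z‖) ^ 2 / 2)) ∂μ - Real.exp (-(t ^ 2 / 2)) =
      ∫ z, (Real.exp (-((t / √n * ‖z‖) ^ 2 / 2)) - Real.exp (-(t ^ 2 / 2))) ∂μ := by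
    rw [integral_sub hi (integrable_const _)]
    simp
  rw [e]
  calc |∫ z, (Real.exp (-((t / √n * ‖z‖) ^ 2 / 2)) - Real.exp (-(t ^ 2 / 2))) ∂μ|
      ≤ ∫ z, |t| * |‖z‖ ^ 2 / n - 1| ∂μ := by
        refine (abs_integral_le_integral_abs).trans (integral_mono
          (hi.sub (integrable_const _)).abs ((hq.integrable (by norm_num)).abs.const_mul _)
          fun z ↦ ?_)
        refine (abs_exp_neg_sq_sub_le _ _).trans ?_
        have e1 : t / √n * ‖z‖ - t = t * (‖z‖ / √n - 1) := by ring
        rw [e1, abs_mul]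
        exact mul_le_mul_of_nonneg_left
          (abs_div_sqrt_sub_one_le (norm_nonneg _) hn0.le) (abs_nonneg _)
    _ = |t| * ∫ z, |‖z‖ ^ 2 / n - 1| ∂μ := integral_const_mul _ _
    _ ≤ |t| * (σ / √n) := by
        gcongr
        apply abs_le_of_sq_le_sq' _ (div_nonneg h.nonneg hs.le) |>.2
        refine (sq_integral_abs_le hq).trans (h.norm_sq.trans ?_)
        rw [div_pow, hs2]

/-- Pass through two constants: `charFun μ` at `(t/√n)x` is close to its Gaussian mean `m` by
Maurey–Pisier, `m` is close to `e^{-t²/2}` because `‖z‖²/n` is close to 1 under `μ`, and `e^{-t²/2}`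
is close to the Gaussian characteristic function. Each error is of order `|t|(1 + σ)/√n` in `L⁶`. -/
lemma IsBoundedIsotropic.lintegral_charFun_sub_pow_six_le (h : IsBoundedIsotropic μ b σ)
    (hn : 0 < n) (t : ℝ) :
    ∫⁻ x, ‖charFun μ ((t / √n) • x) -
        charFun (stdGaussian (EuclideanSpace ℝ (Fin n))) ((t / √n) • x)‖ₑ ^ 6
        ∂(stdGaussian (EuclideanSpace ℝ (Fin n))) ≤
      ENNReal.ofReal (10 ^ 13 * (1 + σ) ^ 6 / n ^ 3) * ‖t‖ₑ ^ 6 := by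
  set γ := stdGaussian (EuclideanSpace ℝ (Fin n)) with hγ
  have hs : 0 < √(n : ℝ) := Real.sqrt_pos.2 (by exact_mod_cast hn)
  have hs2 : √(n : ℝ) ^ 2 = n := Real.sq_sqrt (by positivity)
  have hn0 : (0 : ℝ) < n := by exact_mod_cast hn
  have hs6 : √(n : ℝ) ^ 6 = n ^ 3 := by
    rw [show √(n : ℝ) ^ 6 = (√(n : ℝ) ^ 2) ^ 3 by ring, hs2]
  have hσ := h.nonneg
  have ht : ‖t‖ₑ ^ 6 = ENNReal.ofReal (|t| ^ 6) := by
    rw [← ofReal_norm, ← ENNReal.ofReal_pow (norm_nonneg _), Real.norm_eq_abs]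
  set m := ∫ z, Real.exp (-((t / √n * ‖z‖) ^ 2 / 2)) ∂μ
  set u : EuclideanSpace ℝ (Fin n) → ℂ := fun x ↦ charFun μ ((t / √n) • x)
  have hc : ContDiff ℝ 1 (charFun μ) :=
    contDiff_charFun (n := 1) (h.memLp.mono_exponent (by norm_num))
  have hu : ContDiff ℝ 1 u := hc.comp (contDiff_const_smul _)
  have hui : Integrable u γ := (integrable_const (1 : ℝ)).mono' hu.continuous.aestronglyMeasurable
    (Filter.Eventually.of_forall fun x ↦ norm_charFun_le_one _)
  have hum : ∫ x, u x ∂γ = m := integral_charFun_smul_stdGaussian μ (t / √n)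
  have A : ∫⁻ x, ‖u x - m‖ₑ ^ 6 ∂γ ≤ ENNReal.ofReal (10 ^ 6 * |t| ^ 6 / n ^ 3) := by
    rw [← hum]
    refine (lintegral_enorm_sub_integral_pow_six_le hu hui).trans ?_
    have hx (x : EuclideanSpace ℝ (Fin n)) :
        ∫⁻ y, ‖fderiv ℝ u x y‖ₑ ^ 6 ∂γ ≤ ENNReal.ofReal (11520 * (|t| / √n) ^ 6) := by
      refine (lintegral_enorm_clm_pow_six_le _).trans (ENNReal.ofReal_le_ofReal ?_)
      gcongr
      have hd : fderiv ℝ u x = (t / √n) • fderiv ℝ (charFun μ) ((t / √n) • x) :=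
        fderiv_comp_smul (t / √n)
      rw [hd, norm_smul, Real.norm_eq_abs, abs_div, abs_of_pos hs]
      exact mul_le_of_le_one_right (by positivity) (norm_fderiv_charFun_le h.memLp h.second_moment _)
    refine (mul_le_mul_right (lintegral_mono hx) _).trans ?_
    rw [lintegral_const, measure_univ, mul_one, ← ENNReal.ofReal_pow (by positivity),
      ← ENNReal.ofReal_mul (by positivity)]
    apply ENNReal.ofReal_le_ofReal
    have hpi : (Real.pi / 2) ^ 6 ≤ 1.6 ^ 6 := by
      gcongr
      linarith [Real.pi_lt_d2]
    rw [div_pow |t|, hs6]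
    calc (Real.pi / 2) ^ 6 * (11520 * (|t| ^ 6 / n ^ 3)) ≤ 1.6 ^ 6 * (11520 * (|t| ^ 6 / n ^ 3)) := by
          gcongr
      _ = (1.6 ^ 6 * 11520) * (|t| ^ 6 / n ^ 3) := by ring
      _ ≤ 10 ^ 6 * (|t| ^ 6 / n ^ 3) := by gcongr; norm_num
      _ = _ := by ring
  have B : ‖(m : ℂ) - Real.exp (-(t ^ 2 / 2))‖ₑ ^ 6 ≤ ENNReal.ofReal (σ ^ 6 * |t| ^ 6 / n ^ 3) := by
    rw [← ofReal_norm, ← ENNReal.ofReal_pow (norm_nonneg _), ← Complex.ofReal_sub,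
      Complex.norm_real, Real.norm_eq_abs]
    apply ENNReal.ofReal_le_ofReal
    refine (pow_le_pow_left₀ (abs_nonneg _) (h.abs_integral_exp_sub_le hn t) 6).trans (le_of_eq ?_)
    rw [mul_pow, div_pow, hs6]
    ring
  -- Since `x/√n` is not on the unit sphere, the Gaussian characteristic function is
  -- `e^{-t²‖x‖²/(2n)}` here, and the concentration of `‖x‖²` around `n` is needed.
  have Cx (x : EuclideanSpace ℝ (Fin n)) :
      ‖(Real.exp (-(t ^ 2 / 2)) : ℂ) - charFun γ ((t / √n) • x)‖ₑ ^ 6 ≤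
        ENNReal.ofReal (|t| ^ 6 / n ^ 6) * ‖‖x‖ ^ 2 - n‖ₑ ^ 6 := by
    rw [← ofReal_norm, ← ofReal_norm, ← ENNReal.ofReal_pow (norm_nonneg _),
      ← ENNReal.ofReal_pow (norm_nonneg _), ← ENNReal.ofReal_mul (by positivity)]
    apply ENNReal.ofReal_le_ofReal
    have e : charFun γ ((t / √n) • x) = (Real.exp (-((t / √n * ‖x‖) ^ 2 / 2)) : ℂ) := by
      rw [hγ, charFun_stdGaussian, norm_smul, Real.norm_eq_abs]
      push_cast
      congr 1
      rw [mul_pow, ← Complex.ofReal_pow, sq_abs]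
      push_cast
      ring
    rw [e, ← Complex.ofReal_sub, Complex.norm_real, Real.norm_eq_abs, Real.norm_eq_abs]
    have e2 : |t| ^ 6 / n ^ 6 * |‖x‖ ^ 2 - n| ^ 6 = (|t| * |‖x‖ ^ 2 / n - 1|) ^ 6 := by
      have : ‖x‖ ^ 2 / n - 1 = (‖x‖ ^ 2 - n) / n := by field_simp
      rw [this, abs_div, abs_of_pos hn0]
      field_simp
    rw [e2]
    gcongr
    refine (abs_exp_neg_sq_sub_le _ _).trans ?_
    have e3 : t - t / √n * ‖x‖ = t * (1 - ‖x‖ / √n) := by ring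
    rw [e3, abs_mul, abs_sub_comm 1]
    exact mul_le_mul_of_nonneg_left
      (abs_div_sqrt_sub_one_le (norm_nonneg _) hn0.le) (abs_nonneg _)
  have C : ∫⁻ x, ‖(Real.exp (-(t ^ 2 / 2)) : ℂ) - charFun γ ((t / √n) • x)‖ₑ ^ 6 ∂γ ≤
      ENNReal.ofReal (10 ^ 10 * |t| ^ 6 / n ^ 3) := by
    refine (lintegral_mono Cx).trans ?_
    rw [lintegral_const_mul' _ _ (by simp)]
    refine (mul_le_mul_right lintegral_norm_sq_sub_pow_six_le _).trans ?_
    rw [← ENNReal.ofReal_mul (by positivity)]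
    apply ENNReal.ofReal_le_ofReal
    apply le_of_eq
    field_simp
  have hmu : Measurable fun x ↦ ‖u x - m‖ₑ ^ 6 := by
    have := hu.continuous.measurable
    fun_prop
  calc ∫⁻ x, ‖u x - charFun γ ((t / √n) • x)‖ₑ ^ 6 ∂γ
      ≤ ∫⁻ x, 243 * (‖u x - m‖ₑ ^ 6 + ‖(m : ℂ) - Real.exp (-(t ^ 2 / 2))‖ₑ ^ 6 +
          ‖(Real.exp (-(t ^ 2 / 2)) : ℂ) - charFun γ ((t / √n) • x)‖ₑ ^ 6) ∂γ := by
        refine lintegral_mono fun x ↦ ?_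
        refine le_trans (pow_le_pow_left₀ (by simp) ?_ 6) (add_three_pow_six_le _ _ _)
        have e : u x - charFun γ ((t / √n) • x) = (u x - m) + (m - Real.exp (-(t ^ 2 / 2))) +
          (Real.exp (-(t ^ 2 / 2)) - charFun γ ((t / √n) • x)) := by ring
        rw [e]
        exact (enorm_add_le _ _).trans (by gcongr; exact enorm_add_le _ _)
    _ = 243 * (∫⁻ x, ‖u x - m‖ₑ ^ 6 ∂γ + ‖(m : ℂ) - Real.exp (-(t ^ 2 / 2))‖ₑ ^ 6 +
          ∫⁻ x, ‖(Real.exp (-(t ^ 2 / 2)) : ℂ) - charFun γ ((t / √n) • x)‖ₑ ^ 6 ∂γ) := by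
        rw [lintegral_const_mul' _ _ (by simp), lintegral_add_left (by fun_prop),
          lintegral_add_left hmu, lintegral_const, measure_univ, mul_one]
    _ ≤ 243 * (ENNReal.ofReal (10 ^ 6 * |t| ^ 6 / n ^ 3) +
          ENNReal.ofReal (σ ^ 6 * |t| ^ 6 / n ^ 3) +
          ENNReal.ofReal (10 ^ 10 * |t| ^ 6 / n ^ 3)) := by gcongr
    _ ≤ _ := by
        rw [← ENNReal.ofReal_add (by positivity) (by positivity),
          ← ENNReal.ofReal_add (by positivity) (by positivity),
          show (243 : ℝ≥0∞) = ENNReal.ofReal 243 by simp, ← ENNReal.ofReal_mul (by norm_num), ht,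
          ← ENNReal.ofReal_mul (by positivity)]
        apply ENNReal.ofReal_le_ofReal
        have h1 : 1 ≤ (1 + σ) ^ 6 := one_le_pow₀ (by linarith)
        have h2 : σ ^ 6 ≤ (1 + σ) ^ 6 := by gcongr; linarith
        have h3 : 0 ≤ |t| ^ 6 / (n : ℝ) ^ 3 := by positivity
        calc 243 * (10 ^ 6 * |t| ^ 6 / n ^ 3 + σ ^ 6 * |t| ^ 6 / n ^ 3 + 10 ^ 10 * |t| ^ 6 / n ^ 3)
            = (243 * (10 ^ 6 + 10 ^ 10) + 243 * σ ^ 6) * (|t| ^ 6 / (n : ℝ) ^ 3) := by ring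
          _ ≤ (10 ^ 13 * (1 + σ) ^ 6) * (|t| ^ 6 / (n : ℝ) ^ 3) := by
            gcongr; linarith
          _ = _ := by ring

end

/-! ### Second moments of characteristic functions, for the high frequencies. -/

/-- Symmetrisation: the squared modulus is itself a characteristic function, that of the difference
of two independent copies, so `integral_charFun_smul_stdGaussian` applies to it. -/
lemma norm_charFun_sq_eq {n : ℕ} {μ : Measure (EuclideanSpace ℝ (Fin n))} [IsFiniteMeasure μ]
    (v : EuclideanSpace ℝ (Fin n)) :
    ((‖charFun μ v‖ ^ 2 : ℝ) : ℂ) = charFun ((μ.prod μ).map fun p ↦ p.1 - p.2) v := by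
  rw [charFun_apply (μ := Measure.map _ _) v, integral_map (by fun_prop) (by fun_prop)]
  have e (p : EuclideanSpace ℝ (Fin n) × EuclideanSpace ℝ (Fin n)) :
      Complex.exp ((⟪p.1 - p.2, v⟫ : ℝ) * Complex.I) =
        Complex.exp ((⟪p.1, v⟫ : ℝ) * Complex.I) * Complex.exp ((⟪p.2, -v⟫ : ℝ) * Complex.I) := by
    rw [← Complex.exp_add, inner_sub_left, inner_neg_right]
    push_cast
    ring_nf
  simp_rw [e]
  rw [integral_prod_mul (fun x : EuclideanSpace ℝ (Fin n) ↦ Complex.exp ((⟪x, v⟫ : ℝ) * Complex.I))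
    (fun x : EuclideanSpace ℝ (Fin n) ↦ Complex.exp ((⟪x, -v⟫ : ℝ) * Complex.I)),
    ← charFun_apply, ← charFun_apply, charFun_neg, Complex.mul_conj, Complex.normSq_eq_norm_sq]

lemma add_two_sq_le (a b : ℝ≥0∞) : (a + b) ^ 2 ≤ 2 * (a ^ 2 + b ^ 2) := by
  have h := lintegral_pow_le (Measure.count : Measure (Fin 2)) (f := ![a, b]) (by fun_prop) 1
  rw [lintegral_fintype, lintegral_fintype] at h
  simpa using h

lemma lintegral_inv_sq_le {a : ℝ} (ha : 0 < a) :
    ∫⁻ t in {t : ℝ | a < |t|}, (‖t‖ₑ ^ 2)⁻¹ ≤ ENNReal.ofReal (2 / a) := by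
  have hset : {t : ℝ | a < |t|} = Set.Ioi a ∪ Set.Iio (-a) := by
    ext t
    simp [lt_abs, lt_neg]
  have h1 : ∫⁻ t in Set.Ioi a, (‖t‖ₑ ^ 2)⁻¹ = ENNReal.ofReal (1 / a) := by
    have hi := integrableOn_Ioi_rpow_of_lt (a := -2) (by norm_num) ha
    have hv := integral_Ioi_rpow_of_lt (a := -2) (by norm_num) ha
    norm_num at hv
    rw [Real.rpow_neg_one] at hv
    have hi' : IntegrableOn (fun t : ℝ ↦ (t ^ 2)⁻¹) (Set.Ioi a) := by
      refine hi.congr_fun (fun t ht ↦ ?_) measurableSet_Ioi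
      norm_num
    rw [one_div, ← hv, ofReal_integral_eq_lintegral_ofReal hi'
      (Filter.Eventually.of_forall fun t ↦ by positivity)]
    refine setLIntegral_congr_fun measurableSet_Ioi fun t ht ↦ ?_
    have ht0 : 0 < t := ha.trans ht
    rw [← ofReal_norm, Real.norm_eq_abs, abs_of_pos ht0, ← ENNReal.ofReal_pow ht0.le,
      ← ENNReal.ofReal_inv_of_pos (by positivity)]
  have h2 : ∫⁻ t in Set.Iio (-a), (‖t‖ₑ ^ 2)⁻¹ = ENNReal.ofReal (1 / a) := by
    rw [← h1, ← (Measure.measurePreserving_neg (volume : Measure ℝ)).setLIntegral_comp_preimage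
      measurableSet_Iio (by fun_prop)]
    simp
  rw [hset]
  refine (lintegral_union_le _ _ _).trans (le_of_eq ?_)
  rw [h1, h2, ← ENNReal.ofReal_add (by positivity) (by positivity)]
  congr 1
  ring

lemma div_two_le_enorm_smul {n : ℕ} (hn : 0 < n) {x : EuclideanSpace ℝ (Fin n)} (hx : x ∈ annulus n)
    (t : ℝ) : |t| / 2 ≤ ‖(t / √n) • x‖ ∧ ‖(t / √n) • x‖ ≤ 4 * |t| := by
  have hs : 0 < √(n : ℝ) := Real.sqrt_pos.2 (by exact_mod_cast hn)
  rw [norm_smul, Real.norm_eq_abs, abs_div, abs_of_pos hs]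
  have e1 : |t| / 2 = |t| / √n * (√n / 2) := by field_simp
  have e2 : 4 * |t| = |t| / √n * (4 * √n) := by field_simp
  rw [e1, e2]
  exact ⟨by gcongr; exact hx.1, by gcongr; exact hx.2⟩

/-- On the annulus `‖(t/√n)x‖ ≥ |t|/2`, so the denominator may be replaced by `|t|` at the cost of
`2 ^ k`. -/
lemma enorm_div_pow_le {n : ℕ} (hn : 0 < n) {x : EuclideanSpace ℝ (Fin n)} (hx : x ∈ annulus n)
    (t : ℝ) (a : ℝ≥0∞) (k : ℕ) :
    (a / ‖(t / √n) • x‖ₑ) ^ k ≤ 2 ^ k * (‖t‖ₑ ^ k)⁻¹ * a ^ k := by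
  have h : ‖t‖ₑ / 2 ≤ ‖(t / √n) • x‖ₑ := by
    have e : ‖t‖ₑ / 2 = ENNReal.ofReal (|t| / 2) := by
      rw [ENNReal.ofReal_div_of_pos (by norm_num), ← Real.norm_eq_abs, ofReal_norm]
      simp
    rw [e, ← ofReal_norm]
    exact ENNReal.ofReal_le_ofReal (div_two_le_enorm_smul hn hx t).1
  have h2 : a / ‖(t / √n) • x‖ₑ ≤ 2 * ‖t‖ₑ⁻¹ * a := by
    refine (ENNReal.div_le_div_left h a).trans (le_of_eq ?_)
    rw [div_eq_mul_inv, ENNReal.inv_div (by simp) (by simp), div_eq_mul_inv, mul_comm]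
  refine (pow_le_pow_left₀ (by simp) h2 k).trans (le_of_eq ?_)
  rw [mul_pow, mul_pow, ENNReal.inv_pow]

section

variable {n : ℕ} {μ : Measure (EuclideanSpace ℝ (Fin n))} [IsProbabilityMeasure μ] {b σ : ℝ}

lemma IsBoundedIsotropic.integral_norm_sq (h : IsBoundedIsotropic μ b σ) :
    ∫ x, ‖x‖ ^ 2 ∂μ = n := by
  simp_rw [← (EuclideanSpace.basisFun (Fin n) ℝ).sum_sq_inner_right]
  rw [integral_finsetSum]
  · simp_rw [h.second_moment]
    simp
  · exact fun i _ ↦ (h.integrable_of_continuous (by fun_prop)).integrable (by norm_num)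

lemma IsBoundedIsotropic.integrable_prod_of_continuous (h : IsBoundedIsotropic μ b σ)
    {f : EuclideanSpace ℝ (Fin n) × EuclideanSpace ℝ (Fin n) → ℝ} (hf : Continuous f) :
    Integrable f (μ.prod μ) := by
  set K := Metric.closedBall (0 : EuclideanSpace ℝ (Fin n)) (b * √n)
  have hK : IsCompact K := isCompact_closedBall _ _
  obtain ⟨C, hC⟩ := (hK.prod hK).exists_bound_of_continuousOn hf.continuousOn
  refine (integrable_const C).mono' hf.aestronglyMeasurable ?_
  have h1 := Measure.quasiMeasurePreserving_fst (μ := μ) (ν := μ) |>.ae h.bound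
  have h2 := Measure.quasiMeasurePreserving_snd (μ := μ) (ν := μ) |>.ae h.bound
  filter_upwards [h1, h2] with p hp1 hp2
  exact hC p ⟨by simpa [K] using hp1, by simpa [K] using hp2⟩

/-- Expand `‖x - y‖²`: the two norms fluctuate by `σ²/n`, and the cross term is small because
isotropy gives `E⟨X, Y⟩² = E‖X‖² = n` for independent copies. -/
lemma IsBoundedIsotropic.integral_norm_sub_sq_le (h : IsBoundedIsotropic μ b σ) (hn : 0 < n) :
    ∫ p, (‖p.1 - p.2‖ ^ 2 / n - 2) ^ 2 ∂(μ.prod μ) ≤ 12 * (1 + σ) ^ 2 / n := by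
  have hn0 : (0 : ℝ) < n := by exact_mod_cast hn
  have hi {f : EuclideanSpace ℝ (Fin n) × EuclideanSpace ℝ (Fin n) → ℝ} (hf : Continuous f) :=
    h.integrable_prod_of_continuous hf
  have hσ := h.nonneg
  set A : EuclideanSpace ℝ (Fin n) → ℝ := fun x ↦ (‖x‖ ^ 2 / n - 1) ^ 2 with hA
  have hAc : Continuous A := by fun_prop
  have e1 : ∫ p, A p.1 ∂(μ.prod μ) ≤ σ ^ 2 / n := by
    rw [integral_fun_fst]
    simpa using h.norm_sq
  have e2 : ∫ p, A p.2 ∂(μ.prod μ) ≤ σ ^ 2 / n := by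
    rw [integral_fun_snd]
    simpa using h.norm_sq
  have e3 : ∫ p : EuclideanSpace ℝ (Fin n) × EuclideanSpace ℝ (Fin n), ⟪p.1, p.2⟫ ^ 2
      ∂(μ.prod μ) = n := by
    rw [integral_prod _ (hi (by fun_prop))]
    simp_rw [h.second_moment]
    exact h.integral_norm_sq
  calc ∫ p, (‖p.1 - p.2‖ ^ 2 / n - 2) ^ 2 ∂(μ.prod μ)
      ≤ ∫ p, (3 * A p.1 + (3 * A p.2 + 12 / n ^ 2 * ⟪p.1, p.2⟫ ^ 2)) ∂(μ.prod μ) := by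
        refine integral_mono (hi (by fun_prop)) (hi (by fun_prop)) fun p ↦ ?_
        simp only [hA]
        have e : ‖p.1 - p.2‖ ^ 2 / n - 2 =
            (‖p.1‖ ^ 2 / n - 1) + (‖p.2‖ ^ 2 / n - 1) - 2 * (⟪p.1, p.2⟫ / n) := by
          rw [norm_sub_sq_real]
          ring
        have e' : 12 / (n : ℝ) ^ 2 * ⟪p.1, p.2⟫ ^ 2 = 12 * (⟪p.1, p.2⟫ / n) ^ 2 := by
          rw [div_pow]
          ring
        rw [e, e']
        generalize ‖p.1‖ ^ 2 / n - 1 = x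
        generalize ‖p.2‖ ^ 2 / n - 1 = y
        generalize ⟪p.1, p.2⟫ / (n : ℝ) = z
        nlinarith [sq_nonneg (x - y), sq_nonneg (x + 2 * z), sq_nonneg (y + 2 * z)]
    _ = 3 * ∫ p, A p.1 ∂(μ.prod μ) + (3 * ∫ p, A p.2 ∂(μ.prod μ) + 12 / n ^ 2 *
          ∫ p : EuclideanSpace ℝ (Fin n) × EuclideanSpace ℝ (Fin n), ⟪p.1, p.2⟫ ^ 2 ∂(μ.prod μ)) := by
        rw [integral_add (hi (by fun_prop)) (hi (by fun_prop)),
          integral_add (hi (by fun_prop)) (hi (by fun_prop)), integral_const_mul,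
          integral_const_mul, integral_const_mul]
    _ ≤ 3 * (σ ^ 2 / n) + (3 * (σ ^ 2 / n) + 12 / n ^ 2 * n) := by rw [e3]; gcongr
    _ = (6 * σ ^ 2 + 12) / n := by field_simp; ring
    _ ≤ _ := by gcongr; nlinarith

lemma IsBoundedIsotropic.lintegral_charFun_sq_le (h : IsBoundedIsotropic μ b σ)
    (hn : 0 < n) (t : ℝ) :
    ∫⁻ x, ‖charFun μ ((t / √n) • x)‖ₑ ^ 2 ∂(stdGaussian (EuclideanSpace ℝ (Fin n))) ≤
      ENNReal.ofReal (Real.exp (-(t ^ 2 / 4)) + 12 * (1 + σ) ^ 2 / n) := by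
  set γ := stdGaussian (EuclideanSpace ℝ (Fin n)) with hγ
  have hn0 : (0 : ℝ) < n := by exact_mod_cast hn
  set ν := (μ.prod μ).map fun p ↦ p.1 - p.2 with hν
  have : IsProbabilityMeasure ν := Measure.isProbabilityMeasure_map (by fun_prop)
  have hint : Integrable (fun x ↦ ‖charFun μ ((t / √n) • x)‖ ^ 2) γ := by
    refine (integrable_const (1 : ℝ)).mono' (by fun_prop) (Filter.Eventually.of_forall fun x ↦ ?_)
    rw [norm_pow, norm_norm]
    exact pow_le_one₀ (norm_nonneg _) (norm_charFun_le_one _)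
  have e : ∫ x, ‖charFun μ ((t / √n) • x)‖ ^ 2 ∂γ =
      ∫ z, Real.exp (-((t / √n * ‖z‖) ^ 2 / 2)) ∂ν := by
    have h1 := integral_charFun_smul_stdGaussian ν (t / √n)
    simp_rw [hν, ← norm_charFun_sq_eq] at h1
    rw [integral_complex_ofReal] at h1
    exact_mod_cast h1
  have e2 : ∫ x, ‖charFun μ ((t / √n) • x)‖ ^ 2 ∂γ ≤
      Real.exp (-(t ^ 2 / 4)) + 12 * (1 + σ) ^ 2 / n := by
    rw [e, hν, integral_map (by fun_prop) (by fun_prop)]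
    calc ∫ p : EuclideanSpace ℝ (Fin n) × EuclideanSpace ℝ (Fin n),
          Real.exp (-((t / √n * ‖p.1 - p.2‖) ^ 2 / 2)) ∂(μ.prod μ)
        ≤ ∫ p, (Real.exp (-(t ^ 2 / 4)) + (‖p.1 - p.2‖ ^ 2 / n - 2) ^ 2) ∂(μ.prod μ) := by
          refine integral_mono (h.integrable_prod_of_continuous (by fun_prop))
            (h.integrable_prod_of_continuous (by fun_prop)) fun p ↦ ?_
          simp only
          have e3 : (t / √n * ‖p.1 - p.2‖) ^ 2 / 2 = t ^ 2 / 4 * (2 * (‖p.1 - p.2‖ ^ 2 / n)) := by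
            rw [mul_pow, div_pow, Real.sq_sqrt hn0.le]
            ring
          rw [e3]
          have hq : 0 ≤ ‖p.1 - p.2‖ ^ 2 / n := by positivity
          generalize ‖p.1 - p.2‖ ^ 2 / (n : ℝ) = q at *
          have ht : 0 ≤ t ^ 2 / 4 := by positivity
          -- If `q ≥ 1/2` the exponential is at most `e^{-t²/4}`; otherwise `(q - 2)² ≥ 1` dominates
          -- it, as in Chebyshev's inequality.
          rcases le_total (1 / 2) q with h1 | h1
          · have : Real.exp (-(t ^ 2 / 4 * (2 * q))) ≤ Real.exp (-(t ^ 2 / 4)) := by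
              apply Real.exp_le_exp.2
              nlinarith
            nlinarith [sq_nonneg (q - 2)]
          · have : Real.exp (-(t ^ 2 / 4 * (2 * q))) ≤ 1 := by
              apply Real.exp_le_one_iff.2
              nlinarith [mul_nonneg ht hq]
            nlinarith [Real.exp_pos (-(t ^ 2 / 4))]
      _ = Real.exp (-(t ^ 2 / 4)) + ∫ p, (‖p.1 - p.2‖ ^ 2 / n - 2) ^ 2 ∂(μ.prod μ) := by
          rw [integral_add (integrable_const _) (h.integrable_prod_of_continuous (by fun_prop))]
          simp
      _ ≤ _ := by gcongr; exact h.integral_norm_sub_sq_le hn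
  refine le_trans (le_of_eq ?_) (ENNReal.ofReal_le_ofReal e2)
  rw [ofReal_integral_eq_lintegral_ofReal hint (Filter.Eventually.of_forall fun x ↦ by positivity)]
  refine lintegral_congr fun x ↦ ?_
  rw [← ofReal_norm, ENNReal.ofReal_pow (norm_nonneg _)]

/-! ### Low and high frequencies averaged over the sphere. -/

/-- Average over the sphere of the sixth power of the truncated difference quotients. -/
lemma IsBoundedIsotropic.lintegral_sphere_pow_six_le (h : IsBoundedIsotropic μ b σ)
    (hn : 0 < n) (T : ℝ) :
    ∫⁻ θ, (∫⁻ u in {u : ℝ | |u| ≤ T}, (‖charFun μ (u • (θ : EuclideanSpace ℝ (Fin n))) -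
        charFun (stdGaussian (EuclideanSpace ℝ (Fin n))) (u • (θ : EuclideanSpace ℝ (Fin n)))‖ₑ
          / ‖u‖ₑ) ^ 6) ∂(sphereMeasure n) ≤
      ENNReal.ofReal (10 ^ 17 * T * (1 + σ) ^ 6 / n ^ 3) := by
  set γ := stdGaussian (EuclideanSpace ℝ (Fin n)) with hγ
  set S : Set (EuclideanSpace ℝ (Fin n)) := {v | ‖v‖ ≤ T} with hS
  have hSm : MeasurableSet S := measurableSet_le measurable_norm measurable_const
  have hTm : MeasurableSet {u : ℝ | |u| ≤ T} := measurableSet_le (by fun_prop) measurable_const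
  set ψ : EuclideanSpace ℝ (Fin n) → ℝ≥0∞ := fun v ↦ (‖charFun μ v - charFun γ v‖ₑ / ‖v‖ₑ) ^ 6
    with hψ
  have hψm : Measurable ψ := by fun_prop
  set K := ENNReal.ofReal (10 ^ 13 * (1 + σ) ^ 6 / n ^ 3) with hK
  have hmem (θ : Metric.sphere (0 : EuclideanSpace ℝ (Fin n)) 1) (u : ℝ) :
      ‖u • (θ : EuclideanSpace ℝ (Fin n))‖ = |u| := by
    rw [norm_smul, norm_eq_of_mem_sphere, mul_one, Real.norm_eq_abs]
  have e (θ : Metric.sphere (0 : EuclideanSpace ℝ (Fin n)) 1) :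
      ∫⁻ u in {u : ℝ | |u| ≤ T}, (‖charFun μ (u • (θ : EuclideanSpace ℝ (Fin n))) -
        charFun γ (u • (θ : EuclideanSpace ℝ (Fin n)))‖ₑ / ‖u‖ₑ) ^ 6 =
      ∫⁻ u : ℝ, S.indicator ψ (u • (θ : EuclideanSpace ℝ (Fin n))) := by
    rw [← lintegral_indicator hTm]
    refine lintegral_congr fun u ↦ ?_
    have hiff : u • (θ : EuclideanSpace ℝ (Fin n)) ∈ S ↔ u ∈ {u : ℝ | |u| ≤ T} := by
      simp [hS, hmem]
    by_cases hu : u ∈ {u : ℝ | |u| ≤ T}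
    · rw [Set.indicator_of_mem hu, Set.indicator_of_mem (hiff.2 hu), hψ]
      simp only
      rw [← ofReal_norm (u • (θ : EuclideanSpace ℝ (Fin n))), hmem, ← ofReal_norm u,
        Real.norm_eq_abs]
    · rw [Set.indicator_of_notMem hu, Set.indicator_of_notMem (hiff.not.2 hu)]
  simp_rw [e]
  refine (lintegral_line_le hn (hψm.indicator hSm)).trans ?_
  -- In the annulus `|t|/2 ≤ ‖(t/√n)x‖`, so only `|t| ≤ 2T` contributes. There the sixth moment, of
  -- order `|t|⁶`, cancels the denominator.
  have hb (t : ℝ) : ∫⁻ x in annulus n, S.indicator ψ ((t / √n) • x) ∂γ ≤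
      (Set.Icc (-(2 * T)) (2 * T)).indicator (fun _ ↦ 64 * K) t := by
    by_cases ht : t ∈ Set.Icc (-(2 * T)) (2 * T)
    · rw [Set.indicator_of_mem ht]
      calc ∫⁻ x in annulus n, S.indicator ψ ((t / √n) • x) ∂γ
          ≤ ∫⁻ x in annulus n, 2 ^ 6 * (‖t‖ₑ ^ 6)⁻¹ * ‖charFun μ ((t / √n) • x) -
              charFun γ ((t / √n) • x)‖ₑ ^ 6 ∂γ :=
            setLIntegral_mono' (measurableSet_annulus n) fun x hx ↦
              (Set.indicator_le_self _ _ _).trans (enorm_div_pow_le hn hx t _ 6)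
        _ ≤ ∫⁻ x, 2 ^ 6 * (‖t‖ₑ ^ 6)⁻¹ * ‖charFun μ ((t / √n) • x) -
              charFun γ ((t / √n) • x)‖ₑ ^ 6 ∂γ := setLIntegral_le_lintegral _ _
        _ = 2 ^ 6 * (‖t‖ₑ ^ 6)⁻¹ * ∫⁻ x, ‖charFun μ ((t / √n) • x) -
              charFun γ ((t / √n) • x)‖ₑ ^ 6 ∂γ := lintegral_const_mul _ (by fun_prop)
        _ ≤ 2 ^ 6 * (‖t‖ₑ ^ 6)⁻¹ * (K * ‖t‖ₑ ^ 6) := by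
            gcongr
            exact h.lintegral_charFun_sub_pow_six_le hn t
        _ = 2 ^ 6 * K * ((‖t‖ₑ ^ 6)⁻¹ * ‖t‖ₑ ^ 6) := by ring
        _ ≤ 2 ^ 6 * K * 1 := by gcongr; exact ENNReal.inv_mul_le_one _
        _ = 64 * K := by norm_num
    · rw [Set.indicator_of_notMem ht]
      refine le_of_eq (setLIntegral_eq_zero (measurableSet_annulus n) fun x hx ↦ ?_)
      refine Set.indicator_of_notMem (fun hx' ↦ ht ?_) _
      have h1 := (div_two_le_enorm_smul hn hx t).1.trans hx'
      exact abs_le.1 (by linarith)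
  calc 32 * ∫⁻ t : ℝ, ∫⁻ x in annulus n, S.indicator ψ ((t / √n) • x) ∂γ
      ≤ 32 * ∫⁻ t : ℝ, (Set.Icc (-(2 * T)) (2 * T)).indicator (fun _ ↦ 64 * K) t := by
        gcongr with t
        exact hb t
    _ = ENNReal.ofReal (2048 * (2 * T - -(2 * T))) * K := by
        rw [lintegral_indicator_const measurableSet_Icc, Real.volume_Icc,
          ENNReal.ofReal_mul (by norm_num)]
        norm_num
        ring
    _ ≤ _ := by
        rcases le_total T 0 with hT | hT
        · rw [ENNReal.ofReal_of_nonpos (by linarith), zero_mul]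
          simp
        · rw [hK, ← ENNReal.ofReal_mul (by linarith)]
          apply ENNReal.ofReal_le_ofReal
          have hσ := h.nonneg
          have : 0 ≤ T * (1 + σ) ^ 6 / n ^ 3 := by positivity
          calc 2048 * (2 * T - -(2 * T)) * (10 ^ 13 * (1 + σ) ^ 6 / n ^ 3)
              = 8192 * 10 ^ 13 * (T * (1 + σ) ^ 6 / n ^ 3) := by ring
            _ ≤ 10 ^ 17 * (T * (1 + σ) ^ 6 / n ^ 3) := by gcongr; norm_num
            _ = _ := by ring

/-- No cancellation is used: both characteristic functions are separately small in mean square, and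
integrating `t⁻²` over the tail gives the factor `1/T`. The exponent comes from `‖(t/√n)x‖ ≤ 4|t|`
on the annulus, which forces `|t| > T/4`, and `(T/4)²/4 = T²/64`. -/
lemma IsBoundedIsotropic.lintegral_sphere_tail_le (h : IsBoundedIsotropic μ b σ)
    (hn : 0 < n) {T : ℝ} (hT : 0 < T) :
    ∫⁻ θ, (∫⁻ u in {u : ℝ | |u| ≤ T}ᶜ, (‖charFun μ (u • (θ : EuclideanSpace ℝ (Fin n))) -
        charFun (stdGaussian (EuclideanSpace ℝ (Fin n))) (u • (θ : EuclideanSpace ℝ (Fin n)))‖ₑ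
          / ‖u‖ₑ) ^ 2) ∂(sphereMeasure n) ≤
      ENNReal.ofReal (2048 / T * (2 * Real.exp (-(T ^ 2 / 64)) + 12 * (1 + σ) ^ 2 / n)) := by
  set γ := stdGaussian (EuclideanSpace ℝ (Fin n)) with hγ
  set S : Set (EuclideanSpace ℝ (Fin n)) := {v | ‖v‖ ≤ T}ᶜ with hS
  have hSm : MeasurableSet S := (measurableSet_le measurable_norm measurable_const).compl
  have hTm : MeasurableSet {u : ℝ | |u| ≤ T}ᶜ :=
    (measurableSet_le (by fun_prop) measurable_const).compl
  set ψ : EuclideanSpace ℝ (Fin n) → ℝ≥0∞ := fun v ↦ (‖charFun μ v - charFun γ v‖ₑ / ‖v‖ₑ) ^ 2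
    with hψ
  have hψm : Measurable ψ := by fun_prop
  have hσ := h.nonneg
  set B := 2 * Real.exp (-(T ^ 2 / 64)) + 12 * (1 + σ) ^ 2 / n with hB
  have hmem (θ : Metric.sphere (0 : EuclideanSpace ℝ (Fin n)) 1) (u : ℝ) :
      ‖u • (θ : EuclideanSpace ℝ (Fin n))‖ = |u| := by
    rw [norm_smul, norm_eq_of_mem_sphere, mul_one, Real.norm_eq_abs]
  have e (θ : Metric.sphere (0 : EuclideanSpace ℝ (Fin n)) 1) :
      ∫⁻ u in {u : ℝ | |u| ≤ T}ᶜ, (‖charFun μ (u • (θ : EuclideanSpace ℝ (Fin n))) -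
        charFun γ (u • (θ : EuclideanSpace ℝ (Fin n)))‖ₑ / ‖u‖ₑ) ^ 2 =
      ∫⁻ u : ℝ, S.indicator ψ (u • (θ : EuclideanSpace ℝ (Fin n))) := by
    rw [← lintegral_indicator hTm]
    refine lintegral_congr fun u ↦ ?_
    have hiff : u • (θ : EuclideanSpace ℝ (Fin n)) ∈ S ↔ u ∈ {u : ℝ | |u| ≤ T}ᶜ := by
      simp [hS, hmem]
    by_cases hu : u ∈ {u : ℝ | |u| ≤ T}ᶜ
    · rw [Set.indicator_of_mem hu, Set.indicator_of_mem (hiff.2 hu), hψ]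
      simp only
      rw [← ofReal_norm (u • (θ : EuclideanSpace ℝ (Fin n))), hmem, ← ofReal_norm u,
        Real.norm_eq_abs]
    · rw [Set.indicator_of_notMem hu, Set.indicator_of_notMem (hiff.not.2 hu)]
  simp_rw [e]
  refine (lintegral_line_le hn (hψm.indicator hSm)).trans ?_
  have hgauss (t : ℝ) {x : EuclideanSpace ℝ (Fin n)} (hx : x ∈ annulus n) :
      ‖charFun γ ((t / √n) • x)‖ₑ ^ 2 ≤ ENNReal.ofReal (Real.exp (-(t ^ 2 / 4))) := by
    rw [← ofReal_norm, ← ENNReal.ofReal_pow (norm_nonneg _), hγ, charFun_stdGaussian,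
      Complex.norm_exp, ← Real.exp_nat_mul]
    apply ENNReal.ofReal_le_ofReal
    apply Real.exp_le_exp.2
    have h1 := (div_two_le_enorm_smul hn hx t).1
    have h2 : (|t| / 2) ^ 2 ≤ ‖(t / √n) • x‖ ^ 2 := by gcongr
    rw [div_pow, sq_abs] at h2
    simp only [← Complex.ofReal_pow, ← Complex.ofReal_neg, ← Complex.ofReal_ofNat,
      ← Complex.ofReal_div, Complex.ofReal_re]
    push_cast
    linarith
  have hb (t : ℝ) : ∫⁻ x in annulus n, S.indicator ψ ((t / √n) • x) ∂γ ≤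
      {t : ℝ | T / 4 < |t|}.indicator (fun t ↦ 8 * ENNReal.ofReal B * (‖t‖ₑ ^ 2)⁻¹) t := by
    by_cases ht : t ∈ {t : ℝ | T / 4 < |t|}
    · rw [Set.indicator_of_mem ht]
      have hexp : Real.exp (-(t ^ 2 / 4)) ≤ Real.exp (-(T ^ 2 / 64)) := by
        apply Real.exp_le_exp.2
        have h1 : (T / 4) ^ 2 ≤ |t| ^ 2 := by
          have : T / 4 < |t| := ht
          gcongr
        rw [sq_abs] at h1
        nlinarith
      calc ∫⁻ x in annulus n, S.indicator ψ ((t / √n) • x) ∂γ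
          ≤ ∫⁻ x in annulus n, 2 ^ 2 * (‖t‖ₑ ^ 2)⁻¹ * (2 * (‖charFun μ ((t / √n) • x)‖ₑ ^ 2 +
              ENNReal.ofReal (Real.exp (-(t ^ 2 / 4))))) ∂γ := by
            refine setLIntegral_mono' (measurableSet_annulus n) fun x hx ↦
              (Set.indicator_le_self _ _ _).trans
                ((enorm_div_pow_le hn hx t _ 2).trans ?_)
            refine mul_le_mul_right ?_ _
            refine (pow_le_pow_left₀ (by simp) (enorm_sub_le) 2).trans ?_
            refine le_trans ?_ (mul_le_mul_right (add_le_add_right (hgauss t hx) _) 2)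
            exact add_two_sq_le _ _
        _ ≤ ∫⁻ x, 2 ^ 2 * (‖t‖ₑ ^ 2)⁻¹ * (2 * (‖charFun μ ((t / √n) • x)‖ₑ ^ 2 +
              ENNReal.ofReal (Real.exp (-(t ^ 2 / 4))))) ∂γ := setLIntegral_le_lintegral _ _
        _ = 2 ^ 2 * (‖t‖ₑ ^ 2)⁻¹ * (2 * (∫⁻ x, ‖charFun μ ((t / √n) • x)‖ₑ ^ 2 ∂γ +
              ENNReal.ofReal (Real.exp (-(t ^ 2 / 4))))) := by
            rw [lintegral_const_mul _ (by fun_prop), lintegral_const_mul _ (by fun_prop),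
              lintegral_add_left (by fun_prop), lintegral_const, measure_univ, mul_one]
        _ ≤ 2 ^ 2 * (‖t‖ₑ ^ 2)⁻¹ * (2 * (ENNReal.ofReal (Real.exp (-(t ^ 2 / 4)) +
              12 * (1 + σ) ^ 2 / n) + ENNReal.ofReal (Real.exp (-(t ^ 2 / 4))))) := by
            gcongr
            exact h.lintegral_charFun_sq_le hn t
        _ ≤ 2 ^ 2 * (‖t‖ₑ ^ 2)⁻¹ * (2 * ENNReal.ofReal B) := by
            rw [← ENNReal.ofReal_add (by positivity) (by positivity)]
            gcongr
            rw [hB]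
            linarith
        _ = 8 * ENNReal.ofReal B * (‖t‖ₑ ^ 2)⁻¹ := by ring
    · rw [Set.indicator_of_notMem ht]
      refine le_of_eq (setLIntegral_eq_zero (measurableSet_annulus n) fun x hx ↦ ?_)
      refine Set.indicator_of_notMem (fun hx' ↦ ht ?_) _
      have h1 := (div_two_le_enorm_smul hn hx t).2
      have h2 : T < ‖(t / √n) • x‖ := not_le.1 hx'
      change T / 4 < |t|
      linarith
  calc 32 * ∫⁻ t : ℝ, ∫⁻ x in annulus n, S.indicator ψ ((t / √n) • x) ∂γ
      ≤ 32 * ∫⁻ t : ℝ, {t : ℝ | T / 4 < |t|}.indicator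
          (fun t ↦ 8 * ENNReal.ofReal B * (‖t‖ₑ ^ 2)⁻¹) t := by
        gcongr with t
        exact hb t
    _ = 256 * ENNReal.ofReal B * ∫⁻ t in {t : ℝ | T / 4 < |t|}, (‖t‖ₑ ^ 2)⁻¹ := by
        rw [lintegral_indicator (measurableSet_lt measurable_const (by fun_prop)),
          lintegral_const_mul _ (by fun_prop), ← mul_assoc, ← mul_assoc]
        norm_num
    _ ≤ 256 * ENNReal.ofReal B * ENNReal.ofReal (2 / (T / 4)) := by
        gcongr
        exact lintegral_inv_sq_le (by positivity)
    _ = _ := by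
        rw [show (256 : ℝ≥0∞) = ENNReal.ofReal 256 by simp, ← ENNReal.ofReal_mul (by norm_num),
          ← ENNReal.ofReal_mul (by positivity)]
        congr 1
        field_simp
        ring

end

/-! ### Tails of the distribution functions. -/

/-- Exponential Markov inequality with `2 cosh y ≥ e^{|y|}`; exponential decay is enough for what
follows. -/
lemma gaussianReal_abs_ge_le (a : ℝ) :
    gaussianReal 0 1 {y | a ≤ |y|} ≤ ENNReal.ofReal (4 * Real.exp (-a)) := by
  have hm : MeasurableSet {y : ℝ | a ≤ |y|} := measurableSet_le measurable_const (by fun_prop)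
  calc gaussianReal 0 1 {y | a ≤ |y|}
      = ∫⁻ y, {y : ℝ | a ≤ |y|}.indicator (fun _ ↦ 1) y ∂(gaussianReal 0 1) := by
        rw [lintegral_indicator_const hm, one_mul]
    _ ≤ ∫⁻ y, ENNReal.ofReal (2 * Real.exp (-a) * Real.cosh y) ∂(gaussianReal 0 1) := by
        refine lintegral_mono fun y ↦ ?_
        by_cases hy : y ∈ {y : ℝ | a ≤ |y|}
        · rw [Set.indicator_of_mem hy, ENNReal.one_le_ofReal, mul_comm 2, mul_assoc, Real.exp_neg]
          have h1 : Real.exp |y| ≤ 2 * Real.cosh y := by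
            rw [← Real.cosh_abs, Real.cosh_eq]
            linarith [Real.exp_pos (-|y|)]
          have h2 : Real.exp a ≤ Real.exp |y| := Real.exp_le_exp.2 hy
          rw [inv_mul_eq_div, one_le_div (Real.exp_pos _)]
          exact h2.trans h1
        · rw [Set.indicator_of_notMem hy]
          simp
    _ = ENNReal.ofReal (2 * Real.exp (-a) * Real.exp (1 / 2)) := by
        rw [← ofReal_integral_eq_lintegral_ofReal (integrable_cosh_gaussianReal.const_mul _)
          (Filter.Eventually.of_forall fun y ↦ by have := Real.cosh_pos y; positivity),
          integral_const_mul, integral_cosh_gaussianReal]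
    _ ≤ _ := by
        apply ENNReal.ofReal_le_ofReal
        nlinarith [exp_half_le, Real.exp_pos (-a)]

lemma stdGaussian_abs_inner_ge_le {E : Type*} [NormedAddCommGroup E] [InnerProductSpace ℝ E]
    [FiniteDimensional ℝ E] [MeasurableSpace E] [BorelSpace E] {w : E} (hw : ‖w‖ ≤ 1) (a : ℝ) :
    stdGaussian E {y | a ≤ |⟪w, y⟫|} ≤ ENNReal.ofReal (4 * Real.exp (-a)) := by
  have hm : MeasurableSet {y : ℝ | a ≤ |y|} := measurableSet_le measurable_const (by fun_prop)
  have e : stdGaussian E {y | a ≤ |⟪w, y⟫|} = (stdGaussian E).map (fun y ↦ ⟪w, y⟫) {y | a ≤ |y|} :=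
    (Measure.map_apply (by fun_prop) hm).symm
  rw [e, stdGaussian_map_inner, Measure.map_apply (by fun_prop) hm]
  refine (measure_mono fun y hy ↦ ?_).trans (gaussianReal_abs_ge_le a)
  have hy' : a ≤ |‖w‖ * y| := hy
  rw [abs_mul, abs_norm] at hy'
  exact hy'.trans (mul_le_of_le_one_left (abs_nonneg _) hw)

lemma abs_cdf_sub_cdf_le_one (α β : Measure ℝ) [IsProbabilityMeasure α] [IsProbabilityMeasure β]
    (x : ℝ) : |cdf α x - cdf β x| ≤ 1 := by
  rw [abs_le]
  constructor <;> linarith [cdf_nonneg α x, cdf_le_one α x, cdf_nonneg β x, cdf_le_one β x]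

/-- The difference is at most 1, so its square is at most its modulus, and that is at most the sum
of the two tails. -/
lemma ofReal_cdf_sub_cdf_sq_le (α β : Measure ℝ) [IsProbabilityMeasure α] [IsProbabilityMeasure β]
    (x : ℝ) :
    ENNReal.ofReal ((cdf α x - cdf β x) ^ 2) ≤ α {y | |x| ≤ |y|} + β {y | |x| ≤ |y|} := by
  have h1 := abs_cdf_sub_cdf_le_one α β x
  have h2 : (cdf α x - cdf β x) ^ 2 ≤ |cdf α x - cdf β x| := by
    rw [← sq_abs]
    nlinarith [abs_nonneg (cdf α x - cdf β x)]
  suffices h : |cdf α x - cdf β x| ≤ α.real {y | |x| ≤ |y|} + β.real {y | |x| ≤ |y|} by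
    rw [← ofReal_measureReal (μ := α), ← ofReal_measureReal (μ := β),
      ← ENNReal.ofReal_add (by positivity) (by positivity)]
    exact ENNReal.ofReal_le_ofReal (h2.trans h)
  rcases le_or_gt x 0 with hx | hx
  · have h (α : Measure ℝ) [IsProbabilityMeasure α] : cdf α x ≤ α.real {y | |x| ≤ |y|} := by
      rw [cdf_eq_real]
      refine measureReal_mono fun y (hy : y ≤ x) ↦ ?_
      change |x| ≤ |y|
      rw [abs_of_nonpos hx, abs_of_nonpos (hy.trans hx)]
      linarith
    rw [abs_le]
    constructor <;> linarith [h α, h β, cdf_nonneg α x, cdf_nonneg β x]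
  · have h (α : Measure ℝ) [IsProbabilityMeasure α] : 1 - cdf α x ≤ α.real {y | |x| ≤ |y|} := by
      rw [cdf_eq_real, ← probReal_compl_eq_one_sub measurableSet_Iic]
      refine measureReal_mono fun y hy ↦ ?_
      have hy : x < y := by simpa using hy
      change |x| ≤ |y|
      rw [abs_of_pos hx, abs_of_pos (hx.trans hy)]
      exact hy.le
    rw [abs_le]
    constructor <;> linarith [h α, h β, cdf_le_one α x, cdf_le_one β x]

lemma lintegral_exp_neg_abs_le {c A : ℝ} (hc : 0 < c) (hA : 0 < A) :
    ∫⁻ x in {x : ℝ | A < |x|}, ENNReal.ofReal (Real.exp (-(|x| * c))) ≤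
      ENNReal.ofReal (2 / c * Real.exp (-(A * c))) := by
  have hset : {t : ℝ | A < |t|} = Set.Ioi A ∪ Set.Iio (-A) := by
    ext t
    simp [lt_abs, lt_neg]
  have h1 : ∫⁻ t in Set.Ioi A, ENNReal.ofReal (Real.exp (-(|t| * c))) =
      ENNReal.ofReal (1 / c * Real.exp (-(A * c))) := by
    have hi : IntegrableOn (fun x : ℝ ↦ Real.exp (-c * x)) (Set.Ioi A) :=
      integrableOn_exp_mul_Ioi (by linarith) A
    have hv := integral_exp_mul_Ioi (a := -c) (by linarith) A
    have e : 1 / c * Real.exp (-(A * c)) = ∫ x in Set.Ioi A, Real.exp (-c * x) := by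
      rw [hv, neg_div_neg_eq]
      ring_nf
    rw [e, ofReal_integral_eq_lintegral_ofReal hi
      (Filter.Eventually.of_forall fun t ↦ by positivity)]
    refine setLIntegral_congr_fun measurableSet_Ioi fun t ht ↦ ?_
    have ht0 : 0 < t := hA.trans ht
    rw [abs_of_pos ht0]
    ring_nf
  have h2 : ∫⁻ t in Set.Iio (-A), ENNReal.ofReal (Real.exp (-(|t| * c))) =
      ENNReal.ofReal (1 / c * Real.exp (-(A * c))) := by
    rw [← h1, ← (Measure.measurePreserving_neg (volume : Measure ℝ)).setLIntegral_comp_preimage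
      measurableSet_Iio (by fun_prop)]
    simp
  rw [hset]
  refine (lintegral_union_le _ _ _).trans (le_of_eq ?_)
  rw [h1, h2, ← ENNReal.ofReal_add (by positivity) (by positivity)]
  congr 1
  ring

lemma isProbabilityMeasure_sphereMeasure {n : ℕ} (hn : 0 < n) :
    IsProbabilityMeasure (sphereMeasure n) := by
  have : Nonempty (Fin n) := ⟨⟨0, hn⟩⟩
  have : Nontrivial (EuclideanSpace ℝ (Fin n)) :=
    Module.nontrivial_of_finrank_pos (R := ℝ) (by simpa using hn)
  refine ⟨?_⟩
  rw [sphereMeasure, Measure.smul_apply, smul_eq_mul]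
  refine ENNReal.inv_mul_cancel ?_ (measure_ne_top _ _)
  rw [ne_eq, Measure.measure_univ_eq_zero]
  exact Measure.toSphere_ne_zero _

section

variable {n : ℕ} {μ : Measure (EuclideanSpace ℝ (Fin n))} [IsProbabilityMeasure μ] {b σ : ℝ}

/-- After replacing `θ` by a Gaussian `x`, Fubini's theorem freezes `v`. Then `⟨v, x⟩` is Gaussian
with standard deviation at most `b√n`, which is where boundedness enters. The scale `2b` combines
this with `‖x‖ ≥ √n/2`. -/
lemma lintegral_sphere_measure_abs_inner_ge_le (hn : 0 < n) (hb : 0 < b)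
    (hμ : ∀ᵐ x ∂μ, ‖x‖ ≤ b * √n) (a : ℝ) (ha : 0 ≤ a) :
    ∫⁻ θ, μ {v | a ≤ |⟪v, (θ : EuclideanSpace ℝ (Fin n))⟫|} ∂(sphereMeasure n) ≤
      ENNReal.ofReal (32 * Real.exp (-(a * (2 * b)⁻¹))) := by
  have hs : 0 < √(n : ℝ) := Real.sqrt_pos.2 (by exact_mod_cast hn)
  have hm (a : ℝ) : MeasurableSet {p : EuclideanSpace ℝ (Fin n) × EuclideanSpace ℝ (Fin n) |
      a ≤ |⟪p.2, p.1⟫|} := measurableSet_le measurable_const (by fun_prop)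
  have hF : Measurable fun θ : EuclideanSpace ℝ (Fin n) ↦ μ {v | a ≤ |⟪v, θ⟫|} :=
    measurable_measure_prodMk_left (ν := μ) (hm a)
  refine (lintegral_sphereMeasure_le hn hF).trans ?_
  set γ := stdGaussian (EuclideanSpace ℝ (Fin n))
  calc 8 * ∫⁻ x in annulus n, μ {v | a ≤ |⟪v, ‖x‖⁻¹ • x⟫|} ∂γ
      ≤ 8 * ∫⁻ x in annulus n, μ {v | a * (√n / 2) ≤ |⟪v, x⟫|} ∂γ := by
        gcongr 8 * ?_
        refine setLIntegral_mono' (measurableSet_annulus n) fun x hx ↦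
          measure_mono fun v (hv : a ≤ |⟪v, ‖x‖⁻¹ • x⟫|) ↦ ?_
        have hx0 : 0 < ‖x‖ := lt_of_lt_of_le (by positivity) hx.1
        rw [inner_smul_right, abs_mul, abs_of_pos (by positivity), inv_mul_eq_div,
          le_div_iff₀ hx0] at hv
        exact (mul_le_mul_of_nonneg_left hx.1 ha).trans hv
    _ ≤ 8 * ∫⁻ x, μ {v | a * (√n / 2) ≤ |⟪v, x⟫|} ∂γ := by
        gcongr 8 * ?_
        exact setLIntegral_le_lintegral _ _
    _ = 8 * ∫⁻ v, γ {x | a * (√n / 2) ≤ |⟪v, x⟫|} ∂μ := by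
        congr 1
        exact (Measure.prod_apply (μ := γ) (ν := μ) (hm (a * (√n / 2)))).symm.trans
          (Measure.prod_apply_symm (hm (a * (√n / 2))))
    _ ≤ 8 * ∫⁻ v, ENNReal.ofReal (4 * Real.exp (-(a * (2 * b)⁻¹))) ∂μ := by
        gcongr 8 * ?_
        refine lintegral_mono_ae ?_
        filter_upwards [hμ] with v hv
        have hw : ‖(b * √n)⁻¹ • v‖ ≤ 1 := by
          rw [norm_smul, Real.norm_eq_abs, abs_of_pos (by positivity), inv_mul_le_iff₀ (by positivity)]
          simpa using hv
        refine (measure_mono fun x (hx : a * (√n / 2) ≤ |⟪v, x⟫|) ↦ ?_).trans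
          (stdGaussian_abs_inner_ge_le hw (a * (2 * b)⁻¹))
        change a * (2 * b)⁻¹ ≤ |⟪(b * √n)⁻¹ • v, x⟫|
        rw [real_inner_smul_left, abs_mul, abs_of_pos (by positivity), inv_mul_eq_div,
          le_div_iff₀ (by positivity)]
        refine le_trans (le_of_eq ?_) hx
        field_simp
    _ = _ := by
        rw [lintegral_const, measure_univ, mul_one, show (8 : ℝ≥0∞) = ENNReal.ofReal 8 by simp,
          ← ENNReal.ofReal_mul (by norm_num)]
        congr 1
        ring

/-- Contribution of `|x| > A` to the mean square distance between `F_θ` and `Φ`. -/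
lemma lintegral_sphere_cdf_tail_le (hn : 0 < n) (hb : 1 ≤ b)
    (hμ : ∀ᵐ x ∂μ, ‖x‖ ≤ b * √n) {A : ℝ} (hA : 0 < A) :
    ∫⁻ θ, (∫⁻ x in {x : ℝ | A < |x|}, ENNReal.ofReal
      ((cdf (μ.map fun v ↦ ⟪v, (θ : EuclideanSpace ℝ (Fin n))⟫) x -
        cdf (gaussianReal 0 1) x) ^ 2)) ∂(sphereMeasure n) ≤
      ENNReal.ofReal (144 * b * Real.exp (-(A * (2 * b)⁻¹))) := by
  have hb0 : 0 < b := by linarith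
  have := isProbabilityMeasure_sphereMeasure hn
  have hm : Measurable fun p : Metric.sphere (0 : EuclideanSpace ℝ (Fin n)) 1 × ℝ ↦
      μ {v | |p.2| ≤ |⟪v, (p.1 : EuclideanSpace ℝ (Fin n))⟫|} := by
    have hs : MeasurableSet {q : (Metric.sphere (0 : EuclideanSpace ℝ (Fin n)) 1 × ℝ) ×
        EuclideanSpace ℝ (Fin n) | |q.1.2| ≤ |⟪q.2, (q.1.1 : EuclideanSpace ℝ (Fin n))⟫|} :=
      measurableSet_le (by fun_prop) (by fun_prop)
    exact measurable_measure_prodMk_left (ν := μ) hs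
  have hprob (θ : EuclideanSpace ℝ (Fin n)) : IsProbabilityMeasure (μ.map fun v ↦ ⟪v, θ⟫) :=
    Measure.isProbabilityMeasure_map (by fun_prop)
  calc ∫⁻ θ, (∫⁻ x in {x : ℝ | A < |x|}, ENNReal.ofReal
        ((cdf (μ.map fun v ↦ ⟪v, (θ : EuclideanSpace ℝ (Fin n))⟫) x -
          cdf (gaussianReal 0 1) x) ^ 2)) ∂(sphereMeasure n)
      ≤ ∫⁻ θ, (∫⁻ x in {x : ℝ | A < |x|},
          (μ {v | |x| ≤ |⟪v, (θ : EuclideanSpace ℝ (Fin n))⟫|} +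
            ENNReal.ofReal (4 * Real.exp (-(|x| * (2 * b)⁻¹))))) ∂(sphereMeasure n) := by
        refine lintegral_mono fun θ ↦ lintegral_mono fun x ↦ ?_
        refine (ofReal_cdf_sub_cdf_sq_le _ _ x).trans (add_le_add ?_ ?_)
        · rw [Measure.map_apply (by fun_prop) (measurableSet_le measurable_const (by fun_prop))]
          rfl
        · refine (gaussianReal_abs_ge_le _).trans (ENNReal.ofReal_le_ofReal ?_)
          gcongr
          apply mul_le_of_le_one_right (abs_nonneg _)
          apply inv_le_one_of_one_le₀
          linarith
    _ = ∫⁻ x in {x : ℝ | A < |x|}, (∫⁻ θ,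
          (μ {v | |x| ≤ |⟪v, (θ : EuclideanSpace ℝ (Fin n))⟫|} +
            ENNReal.ofReal (4 * Real.exp (-(|x| * (2 * b)⁻¹)))) ∂(sphereMeasure n)) := by
        refine lintegral_lintegral_swap (Measurable.aemeasurable ?_)
        exact hm.add (by fun_prop)
    _ ≤ ∫⁻ x in {x : ℝ | A < |x|}, 36 * ENNReal.ofReal (Real.exp (-(|x| * (2 * b)⁻¹))) := by
        refine lintegral_mono fun x ↦ ?_
        rw [lintegral_add_right _ measurable_const, lintegral_const, measure_univ, mul_one]
        refine (add_le_add_left (lintegral_sphere_measure_abs_inner_ge_le hn hb0 hμ |x|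
          (abs_nonneg _)) _).trans (le_of_eq ?_)
        rw [← ENNReal.ofReal_add (by positivity) (by positivity),
          show (36 : ℝ≥0∞) = ENNReal.ofReal 36 by simp, ← ENNReal.ofReal_mul (by norm_num)]
        congr 1
        ring
    _ ≤ 36 * ENNReal.ofReal (2 / (2 * b)⁻¹ * Real.exp (-(A * (2 * b)⁻¹))) := by
        rw [lintegral_const_mul _ (by fun_prop)]
        gcongr
        exact lintegral_exp_neg_abs_le (by positivity) hA
    _ = _ := by
        rw [show (36 : ℝ≥0∞) = ENNReal.ofReal 36 by simp, ← ENNReal.ofReal_mul (by norm_num)]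
        congr 1
        field_simp
        ring

end

/-! ### The Kolmogorov distance and its relation to the low-frequency energy. -/

lemma measurable_weightedSumCDF {n : ℕ} (μ : Measure (EuclideanSpace ℝ (Fin n)))
    [IsProbabilityMeasure μ] :
    Measurable fun p : EuclideanSpace ℝ (Fin n) × ℝ ↦ weightedSumCDF μ id p.1 p.2 := by
  have hs : MeasurableSet {q : (EuclideanSpace ℝ (Fin n) × ℝ) × EuclideanSpace ℝ (Fin n) |
      ⟪q.2, q.1.1⟫ ≤ q.1.2} := measurableSet_le (by fun_prop) (by fun_prop)
  exact (measurable_measure_prodMk_left (ν := μ) hs).ennreal_toReal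

lemma weightedSumCDF_id {n : ℕ} (μ : Measure (EuclideanSpace ℝ (Fin n)))
    [IsProbabilityMeasure μ] (θ : EuclideanSpace ℝ (Fin n)) :
    weightedSumCDF μ id θ = cdf (μ.map fun v ↦ ⟪v, θ⟫) := by
  have : IsProbabilityMeasure (μ.map fun v ↦ ⟪v, θ⟫) :=
    Measure.isProbabilityMeasure_map (by fun_prop)
  ext x
  rw [cdf_eq_real, map_measureReal_apply (by fun_prop) measurableSet_Iic]
  rfl

lemma weightedSumCDF_map {Ω : Type*} [MeasurableSpace Ω] (P : Measure Ω) {n : ℕ}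
    {X : Ω → EuclideanSpace ℝ (Fin n)} (hX : Measurable X) :
    weightedSumCDF P X = weightedSumCDF (P.map X) id := by
  ext θ x
  rw [weightedSumCDF, weightedSumCDF, map_measureReal_apply hX
    (measurableSet_le (by fun_prop) measurable_const)]
  rfl

section

variable (α β : Measure ℝ) [IsProbabilityMeasure α] [IsProbabilityMeasure β]

lemma bddAbove_abs_cdf_sub_cdf {ι : Type*} (f : ι → ℝ) :
    BddAbove (Set.range fun i ↦ |cdf α (f i) - cdf β (f i)|) :=
  ⟨1, by rintro _ ⟨i, rfl⟩; exact abs_cdf_sub_cdf_le_one α β _⟩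

lemma abs_cdf_sub_cdf_le_kolmogorovDist (x : ℝ) :
    |cdf α x - cdf β x| ≤ kolmogorovDist (cdf α) (cdf β) :=
  le_ciSup (bddAbove_abs_cdf_sub_cdf α β id) x

lemma kolmogorovDist_le_one : kolmogorovDist (cdf α) (cdf β) ≤ 1 :=
  ciSup_le fun x ↦ abs_cdf_sub_cdf_le_one α β x

lemma kolmogorovDist_nonneg (F G : ℝ → ℝ) : 0 ≤ kolmogorovDist F G :=
  Real.iSup_nonneg fun _ ↦ abs_nonneg _

/-- By right-continuity rational points suffice; the countable supremum makes the distance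
measurable in `θ`. -/
lemma kolmogorovDist_eq_iSup_rat :
    kolmogorovDist (cdf α) (cdf β) = ⨆ q : ℚ, |cdf α q - cdf β q| := by
  have hb := bddAbove_abs_cdf_sub_cdf α β (fun q : ℚ ↦ (q : ℝ))
  apply le_antisymm
  · refine ciSup_le fun x ↦ ?_
    by_contra! hlt
    have hc : ContinuousWithinAt (fun y ↦ |cdf α y - cdf β y|) (Set.Ioi x) x :=
      ((((cdf α).right_continuous x).sub ((cdf β).right_continuous x)).abs).mono
        Set.Ioi_subset_Ici_self
    obtain ⟨u, hu, hsub⟩ := mem_nhdsGT_iff_exists_Ioo_subset.1 (hc (lt_mem_nhds hlt))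
    obtain ⟨q, hq1, hq2⟩ := exists_rat_btwn (Set.mem_Ioi.1 hu)
    exact absurd (le_ciSup hb q) (not_le.2 (hsub ⟨hq1, hq2⟩))
  · exact ciSup_le fun q ↦ abs_cdf_sub_cdf_le_kolmogorovDist α β q

variable {α β}

lemma ofReal_l2Dist_sq (hα : Integrable id α) (hβ : Integrable id β) :
    ENNReal.ofReal (l2Dist (cdf α) (cdf β) ^ 2) =
      ∫⁻ x, ENNReal.ofReal ((cdf α x - cdf β x) ^ 2) := by
  have hH := integrable_cdf_sub_cdf hα hβ
  have hi : Integrable fun x ↦ (cdf α x - cdf β x) ^ 2 := by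
    refine hH.norm.mono' (hH.1.pow 2) (Filter.Eventually.of_forall fun x ↦ ?_)
    have := abs_cdf_sub_cdf_le_one α β x
    rw [norm_pow, Real.norm_eq_abs]
    nlinarith [abs_nonneg (cdf α x - cdf β x)]
  rw [l2Dist, Real.sq_sqrt (integral_nonneg fun x ↦ sq_nonneg _),
    ofReal_integral_eq_lintegral_ofReal hi (Filter.Eventually.of_forall fun x ↦ sq_nonneg _)]

lemma measurableSet_abs_le (T : ℝ) : MeasurableSet {u : ℝ | |u| ≤ T} :=
  measurableSet_le (by fun_prop) measurable_const

/-- Splitting of the `L²`-distance according to the size of the frequencies. -/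
lemma lintegral_charFun_split (hα : Integrable id α) (hβ : Integrable id β) (T : ℝ) :
    ENNReal.ofReal (2 * Real.pi) * ENNReal.ofReal (l2Dist (cdf α) (cdf β) ^ 2) =
      (∫⁻ t in {u : ℝ | |u| ≤ T}, (‖charFun α t - charFun β t‖ₑ / ‖t‖ₑ) ^ 2) +
        ∫⁻ t in {u : ℝ | |u| ≤ T}ᶜ, (‖charFun α t - charFun β t‖ₑ / ‖t‖ₑ) ^ 2 := by
  rw [ofReal_l2Dist_sq hα hβ, lintegral_cdf_sub_cdf_sq hα hβ,
    lintegral_add_compl _ (measurableSet_abs_le T)]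

/-- Bound on the low-frequency part of the `L²`-distance by the Kolmogorov distance. -/
lemma lintegral_low_frequency_le (hα : Integrable id α) (hβ : Integrable id β) (T : ℝ)
    {l κ η : ℝ} (hl : 0 < l) (hκ : 0 ≤ κ) (hη : 0 < η) :
    (∫⁻ t in {u : ℝ | |u| ≤ T}, (‖charFun α t - charFun β t‖ₑ / ‖t‖ₑ) ^ 2) ≤
      ENNReal.ofReal (3 * l * κ) * ENNReal.ofReal (kolmogorovDist (cdf α) (cdf β)) +
      ENNReal.ofReal (3 * l * η) +
      ENNReal.ofReal (3 * l / η) *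
        (∫⁻ x in {x : ℝ | κ ^ 2 / 2 < |x|}, ENNReal.ofReal ((cdf α x - cdf β x) ^ 2)) +
      ENNReal.ofReal (1 / l ^ 4) *
        (∫⁻ t in {u : ℝ | |u| ≤ T}, (‖charFun α t - charFun β t‖ₑ / ‖t‖ₑ) ^ 2) ^ 3 := by
  set V := ∫⁻ t in {u : ℝ | |u| ≤ T}, (‖charFun α t - charFun β t‖ₑ / ‖t‖ₑ) ^ 2
  set τ := ∫⁻ x in {x : ℝ | κ ^ 2 / 2 < |x|}, ENNReal.ofReal ((cdf α x - cdf β x) ^ 2)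
  set ω := l2Dist (cdf α) (cdf β)
  set ρ := kolmogorovDist (cdf α) (cdf β)
  have hω : 0 ≤ ω := Real.sqrt_nonneg _
  have hρ : 0 ≤ ρ := kolmogorovDist_nonneg _ _
  have hsplit := lintegral_charFun_split hα hβ T
  rw [← ENNReal.ofReal_mul (by positivity)] at hsplit
  have hVle : V ≤ ENNReal.ofReal (2 * Real.pi * ω ^ 2) := by
    rw [hsplit]
    exact le_self_add
  have hVt : V ≠ ∞ := ne_top_of_le_ne_top ENNReal.ofReal_ne_top hVle
  have hτle : τ ≤ ENNReal.ofReal (ω ^ 2) := by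
    rw [ofReal_l2Dist_sq hα hβ]
    exact setLIntegral_le_lintegral _ _
  have hτt : τ ≠ ∞ := ne_top_of_le_ne_top ENNReal.ofReal_ne_top hτle
  obtain ⟨v, hv0, hv⟩ : ∃ v : ℝ, 0 ≤ v ∧ V = ENNReal.ofReal v :=
    ⟨V.toReal, ENNReal.toReal_nonneg, (ENNReal.ofReal_toReal hVt).symm⟩
  obtain ⟨s, hs0, hs⟩ : ∃ s : ℝ, 0 ≤ s ∧ τ = ENNReal.ofReal s :=
    ⟨τ.toReal, ENNReal.toReal_nonneg, (ENNReal.ofReal_toReal hτt).symm⟩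
  have hvω : v ≤ 2 * Real.pi * ω ^ 2 := by
    rwa [hv, ENNReal.ofReal_le_ofReal_iff (by positivity)] at hVle
  -- The cut at `|x| = κ²/2` gives an interval of length `κ²`, on which the integrand is at most
  -- `ρ²`.
  have hωs : ω ^ 2 ≤ κ ^ 2 * ρ ^ 2 + s := by
    have hset : {x : ℝ | κ ^ 2 / 2 < |x|} = {x : ℝ | |x| ≤ κ ^ 2 / 2}ᶜ := by
      ext x
      simp
    have hIcc : {x : ℝ | |x| ≤ κ ^ 2 / 2} = Set.Icc (-(κ ^ 2 / 2)) (κ ^ 2 / 2) := by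
      ext x
      simp [abs_le]
    have h : ENNReal.ofReal (ω ^ 2) ≤ ENNReal.ofReal (κ ^ 2 * ρ ^ 2 + s) := by
      rw [ofReal_l2Dist_sq hα hβ, ENNReal.ofReal_add (by positivity) hs0, ← hs,
        ← lintegral_add_compl _ (measurableSet_abs_le (κ ^ 2 / 2)), ← hset]
      gcongr
      calc ∫⁻ x in {x : ℝ | |x| ≤ κ ^ 2 / 2}, ENNReal.ofReal ((cdf α x - cdf β x) ^ 2)
          ≤ ∫⁻ x in {x : ℝ | |x| ≤ κ ^ 2 / 2}, ENNReal.ofReal (ρ ^ 2) := by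
            refine lintegral_mono fun x ↦ ENNReal.ofReal_le_ofReal ?_
            rw [← sq_abs]
            exact pow_le_pow_left₀ (abs_nonneg _) (abs_cdf_sub_cdf_le_kolmogorovDist α β x) 2
        _ = _ := by
            rw [setLIntegral_const, hIcc, Real.volume_Icc, ← ENNReal.ofReal_mul (by positivity)]
            congr 1
            ring
    rwa [ENNReal.ofReal_le_ofReal_iff (by positivity)] at h
  -- The product `η · (s/η) = s` avoids `√s`: the bound stays linear in the tail `s`, so it can be
  -- averaged over `θ`.
  have hω2 : ω ≤ κ * ρ + η + s / η := by
    refine abs_le_of_sq_le_sq' (hωs.trans ?_) (by positivity) |>.2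
    have h1 : η * (s / η) = s := by field_simp
    have h2 : 0 ≤ s / η := by positivity
    have h3 : 0 ≤ κ * ρ := by positivity
    generalize s / η = z at *
    nlinarith [mul_nonneg h3 hη.le, mul_nonneg h3 h2, sq_nonneg η, sq_nonneg z]
  have hmain : v ≤ 3 * l * κ * ρ + 3 * l * η + 3 * l / η * s + 1 / l ^ 4 * v ^ 3 := by
    have e : 3 * l * κ * ρ + 3 * l * η + 3 * l / η * s = 3 * l * (κ * ρ + η + s / η) := by ring
    rw [e]
    have h4 : 3 * l * ω ≤ 3 * l * (κ * ρ + η + s / η) := by gcongr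
    -- If `v ≤ l²`, then `v² ≤ l² · 9ω²` because `2π ≤ 9`; if `v ≥ l²`, then `v ≤ v³/l⁴`.
    rcases le_total v (l ^ 2) with hc | hc
    · have h5 : v ≤ 3 * l * ω := by
        refine abs_le_of_sq_le_sq' ?_ (by positivity) |>.2
        have h6 : v ≤ 9 * ω ^ 2 := hvω.trans (by nlinarith [Real.pi_lt_d2, sq_nonneg ω])
        nlinarith [mul_le_mul hc h6 hv0 (by positivity)]
      have h7 : 0 ≤ 1 / l ^ 4 * v ^ 3 := by positivity
      linarith
    · have h5 : v ≤ 1 / l ^ 4 * v ^ 3 := by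
        rw [one_div, inv_mul_eq_div, le_div_iff₀ (by positivity)]
        have h6 : l ^ 4 ≤ v ^ 2 := by
          calc l ^ 4 = (l ^ 2) ^ 2 := by ring
            _ ≤ v ^ 2 := by gcongr
        calc v * l ^ 4 ≤ v * v ^ 2 := by gcongr
          _ = v ^ 3 := by ring
      have h7 : 0 ≤ 3 * l * ω := by positivity
      linarith
  rw [hv, hs, ← ENNReal.ofReal_mul (by positivity), ← ENNReal.ofReal_mul (by positivity),
    ← ENNReal.ofReal_pow hv0, ← ENNReal.ofReal_mul (by positivity),
    ← ENNReal.ofReal_add (by positivity) (by positivity),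
    ← ENNReal.ofReal_add (by positivity) (by positivity),
    ← ENNReal.ofReal_add (by positivity) (by positivity)]
  exact ENNReal.ofReal_le_ofReal hmain

lemma lintegral_low_frequency_pow_three_le (T : ℝ) :
    (∫⁻ t in {u : ℝ | |u| ≤ T}, (‖charFun α t - charFun β t‖ₑ / ‖t‖ₑ) ^ 2) ^ 3 ≤
      ENNReal.ofReal (2 * T) ^ 2 *
        ∫⁻ t in {u : ℝ | |u| ≤ T}, (‖charFun α t - charFun β t‖ₑ / ‖t‖ₑ) ^ 6 := by
  have hIcc : {x : ℝ | |x| ≤ T} = Set.Icc (-T) T := by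
    ext x
    simp [abs_le]
  have h := lintegral_pow_le (volume.restrict {u : ℝ | |u| ≤ T})
    (f := fun t ↦ (‖charFun α t - charFun β t‖ₑ / ‖t‖ₑ) ^ 2) (by fun_prop) 2
  refine h.trans (le_of_eq ?_)
  congr 1
  · rw [Measure.restrict_apply_univ, hIcc, Real.volume_Icc]
    ring_nf
  · refine lintegral_congr fun t ↦ ?_
    rw [← pow_mul]

/-- Either `V ≤ q` or `V² ≥ q²`. Applied pointwise in `θ`, it bounds a mean by a third moment. -/
lemma le_add_pow_three (V : ℝ≥0∞) {q : ℝ} (hq : 0 < q) :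
    V ≤ ENNReal.ofReal q + ENNReal.ofReal (1 / q ^ 2) * V ^ 3 := by
  rcases eq_or_ne V ∞ with rfl | hV
  · rw [ENNReal.top_pow (by norm_num), ENNReal.mul_top (by simp; positivity)]
    simp
  · rw [← ENNReal.ofReal_toReal hV]
    have hv : 0 ≤ V.toReal := ENNReal.toReal_nonneg
    generalize V.toReal = v at *
    rw [← ENNReal.ofReal_pow hv, ← ENNReal.ofReal_mul (by positivity),
      ← ENNReal.ofReal_add (by positivity) (by positivity)]
    apply ENNReal.ofReal_le_ofReal
    rcases le_total v q with hc | hc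
    · have : 0 ≤ 1 / q ^ 2 * v ^ 3 := by positivity
      linarith
    · have : v ≤ 1 / q ^ 2 * v ^ 3 := by
        rw [one_div, inv_mul_eq_div, le_div_iff₀ (by positivity)]
        calc v * q ^ 2 ≤ v * v ^ 2 := by gcongr
          _ = v ^ 3 := by ring
      linarith

end

/-! ### Averaging the frequency bounds over directions. -/

lemma charFun_map_inner {n : ℕ} (μ : Measure (EuclideanSpace ℝ (Fin n)))
    (θ : EuclideanSpace ℝ (Fin n)) (t : ℝ) :
    charFun (μ.map fun v ↦ ⟪v, θ⟫) t = charFun μ (t • θ) := by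
  rw [charFun_apply_real, charFun_apply, integral_map (by fun_prop) (by fun_prop)]
  refine integral_congr_ae (Filter.Eventually.of_forall fun x ↦ ?_)
  simp [inner_smul_right]

/-- Unit marginals of the standard Gaussian are standard; this lets the one-dimensional difference
be written as a difference of `n`-dimensional characteristic functions along the line through `θ`.
-/
lemma charFun_gaussianReal_eq {n : ℕ} (θ : Metric.sphere (0 : EuclideanSpace ℝ (Fin n)) 1)
    (t : ℝ) : charFun (gaussianReal 0 1) t =
      charFun (stdGaussian (EuclideanSpace ℝ (Fin n))) (t • (θ : EuclideanSpace ℝ (Fin n))) := by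
  rw [← charFun_map_inner]
  have h := stdGaussian_map_inner (θ : EuclideanSpace ℝ (Fin n))
  have hθ : ‖(θ : EuclideanSpace ℝ (Fin n))‖ = 1 := by simp
  simp_rw [hθ, one_mul, Measure.map_id'] at h
  rw [← h]
  simp_rw [real_inner_comm]

section

variable {n : ℕ} {μ : Measure (EuclideanSpace ℝ (Fin n))} [IsProbabilityMeasure μ] {b σ : ℝ}

lemma isProbabilityMeasure_map_inner (μ : Measure (EuclideanSpace ℝ (Fin n)))
    [IsProbabilityMeasure μ] (θ : EuclideanSpace ℝ (Fin n)) :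
    IsProbabilityMeasure (μ.map fun v ↦ ⟪v, θ⟫) :=
  Measure.isProbabilityMeasure_map (by fun_prop)

lemma IsBoundedIsotropic.integrable_map_inner (h : IsBoundedIsotropic μ b σ)
    (θ : EuclideanSpace ℝ (Fin n)) : Integrable id (μ.map fun v ↦ ⟪v, θ⟫) := by
  rw [integrable_map_measure (by fun_prop) (by fun_prop)]
  exact (h.integrable_of_continuous (f := fun v ↦ ⟪v, θ⟫) (by fun_prop)).integrable one_le_two

lemma integrable_id_gaussianReal : Integrable id (gaussianReal 0 1) :=
  (memLp_id_gaussianReal 1).integrable le_rfl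

/-- The part of `2π ω²(F_θ, Φ)` coming from the frequencies in `S`. -/
def frequencyEnergy (μ : Measure (EuclideanSpace ℝ (Fin n))) (S : Set ℝ)
    (θ : EuclideanSpace ℝ (Fin n)) : ℝ≥0∞ :=
  ∫⁻ t in S, (‖charFun (μ.map fun v ↦ ⟪v, θ⟫) t - charFun (gaussianReal 0 1) t‖ₑ / ‖t‖ₑ) ^ 2

lemma measurable_frequencyEnergy (S : Set ℝ) : Measurable (frequencyEnergy μ S) := by
  unfold frequencyEnergy
  simp_rw [charFun_map_inner]
  refine Measurable.lintegral_prod_right' (f := fun p : EuclideanSpace ℝ (Fin n) × ℝ ↦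
    (‖charFun μ (p.2 • p.1) - charFun (gaussianReal 0 1) p.2‖ₑ / ‖p.2‖ₑ) ^ 2) ?_
  fun_prop

lemma IsBoundedIsotropic.lintegral_frequencyEnergy_compl_le (h : IsBoundedIsotropic μ b σ)
    (hn : 0 < n) {T : ℝ} (hT : 0 < T) :
    ∫⁻ θ, frequencyEnergy μ {u : ℝ | |u| ≤ T}ᶜ θ ∂(sphereMeasure n) ≤
      ENNReal.ofReal (2048 / T * (2 * Real.exp (-(T ^ 2 / 64)) + 12 * (1 + σ) ^ 2 / n)) := by
  refine le_of_eq_of_le ?_ (h.lintegral_sphere_tail_le hn hT)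
  refine lintegral_congr fun θ ↦ ?_
  simp_rw [frequencyEnergy, charFun_map_inner, charFun_gaussianReal_eq θ]

lemma IsBoundedIsotropic.lintegral_frequencyEnergy_pow_three_le (h : IsBoundedIsotropic μ b σ)
    (hn : 0 < n) {T : ℝ} (hT : 0 < T) :
    ∫⁻ θ, frequencyEnergy μ {u : ℝ | |u| ≤ T} θ ^ 3 ∂(sphereMeasure n) ≤
      ENNReal.ofReal (4 * 10 ^ 17 * T ^ 3 * (1 + σ) ^ 6 / n ^ 3) := by
  calc ∫⁻ θ, frequencyEnergy μ {u : ℝ | |u| ≤ T} θ ^ 3 ∂(sphereMeasure n)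
      ≤ ∫⁻ θ, ENNReal.ofReal (2 * T) ^ 2 *
          (∫⁻ u in {u : ℝ | |u| ≤ T}, (‖charFun μ (u • (θ : EuclideanSpace ℝ (Fin n))) -
        charFun (stdGaussian (EuclideanSpace ℝ (Fin n))) (u • (θ : EuclideanSpace ℝ (Fin n)))‖ₑ
          / ‖u‖ₑ) ^ 6) ∂(sphereMeasure n) := by
        refine lintegral_mono fun θ ↦ ?_
        have := isProbabilityMeasure_map_inner μ (θ : EuclideanSpace ℝ (Fin n))
        refine (lintegral_low_frequency_pow_three_le T).trans (le_of_eq ?_)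
        simp_rw [charFun_map_inner, charFun_gaussianReal_eq θ]
    _ ≤ ENNReal.ofReal (2 * T) ^ 2 * ENNReal.ofReal (10 ^ 17 * T * (1 + σ) ^ 6 / n ^ 3) := by
        rw [lintegral_const_mul' _ _ (ENNReal.pow_ne_top ENNReal.ofReal_ne_top)]
        gcongr
        exact h.lintegral_sphere_pow_six_le hn T
    _ = _ := by
        rw [← ENNReal.ofReal_pow (by positivity), ← ENNReal.ofReal_mul (by positivity)]
        congr 1
        ring

lemma IsBoundedIsotropic.lintegral_l2Dist_sq_le (h : IsBoundedIsotropic μ b σ)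
    (hn : 0 < n) {T : ℝ} (hT : 0 < T) :
    ENNReal.ofReal (2 * Real.pi) * ∫⁻ θ, ENNReal.ofReal (l2Dist
        (cdf (μ.map fun v ↦ ⟪v, (θ : EuclideanSpace ℝ (Fin n))⟫)) (cdf (gaussianReal 0 1)) ^ 2)
        ∂(sphereMeasure n) ≤
      ∫⁻ θ, frequencyEnergy μ {u : ℝ | |u| ≤ T} θ ∂(sphereMeasure n) +
      ENNReal.ofReal (2048 / T * (2 * Real.exp (-(T ^ 2 / 64)) + 12 * (1 + σ) ^ 2 / n)) := by
  rw [← lintegral_const_mul' _ _ ENNReal.ofReal_ne_top]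
  refine le_trans (le_of_eq ?_)
    (add_le_add_right (h.lintegral_frequencyEnergy_compl_le hn hT) _)
  have hm : Measurable fun θ : Metric.sphere (0 : EuclideanSpace ℝ (Fin n)) 1 ↦
      frequencyEnergy μ {u : ℝ | |u| ≤ T} θ :=
    (measurable_frequencyEnergy _).comp measurable_subtype_coe
  rw [← lintegral_add_left hm]
  refine lintegral_congr fun θ ↦ ?_
  have := isProbabilityMeasure_map_inner μ (θ : EuclideanSpace ℝ (Fin n))
  exact lintegral_charFun_split (h.integrable_map_inner θ) integrable_id_gaussianReal T

lemma IsBoundedIsotropic.lintegral_frequencyEnergy_le (h : IsBoundedIsotropic μ b σ)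
    (hn : 0 < n) {T q : ℝ} (hT : 0 < T) (hq : 0 < q) :
    ∫⁻ θ, frequencyEnergy μ {u : ℝ | |u| ≤ T} θ ∂(sphereMeasure n) ≤
      ENNReal.ofReal (q + 1 / q ^ 2 * (4 * 10 ^ 17 * T ^ 3 * (1 + σ) ^ 6 / n ^ 3)) := by
  have := isProbabilityMeasure_sphereMeasure hn
  have hσ := h.nonneg
  refine (lintegral_mono fun θ ↦ le_add_pow_three _ hq).trans ?_
  rw [lintegral_add_left measurable_const, lintegral_const, measure_univ, mul_one,
    lintegral_const_mul' _ _ ENNReal.ofReal_ne_top, ENNReal.ofReal_add hq.le (by positivity),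
    ENNReal.ofReal_mul (p := 1 / q ^ 2) (by positivity)]
  gcongr
  exact h.lintegral_frequencyEnergy_pow_three_le hn hT

lemma measurable_kolmogorovDist (μ : Measure (EuclideanSpace ℝ (Fin n))) [IsProbabilityMeasure μ] :
    Measurable fun θ : EuclideanSpace ℝ (Fin n) ↦
      kolmogorovDist (cdf (μ.map fun v ↦ ⟪v, θ⟫)) (cdf (gaussianReal 0 1)) := by
  have e : (fun θ : EuclideanSpace ℝ (Fin n) ↦
      kolmogorovDist (cdf (μ.map fun v ↦ ⟪v, θ⟫)) (cdf (gaussianReal 0 1))) =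
      fun θ ↦ ⨆ q : ℚ, |weightedSumCDF μ id θ q - cdf (gaussianReal 0 1) q| := by
    ext θ
    have := isProbabilityMeasure_map_inner μ θ
    rw [kolmogorovDist_eq_iSup_rat, weightedSumCDF_id]
  rw [e]
  refine Measurable.iSup fun q ↦ ?_
  have := (measurable_weightedSumCDF μ).comp
    (measurable_id.prodMk (measurable_const (a := (q : ℝ))))
  exact (this.sub_const _).norm

lemma lintegral_ofReal_kolmogorovDist (hn : 0 < n) :
    ∫⁻ θ, ENNReal.ofReal (kolmogorovDist
        (cdf (μ.map fun v ↦ ⟪v, (θ : EuclideanSpace ℝ (Fin n))⟫)) (cdf (gaussianReal 0 1)))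
        ∂(sphereMeasure n) =
      ENNReal.ofReal (∫ θ, kolmogorovDist
        (cdf (μ.map fun v ↦ ⟪v, (θ : EuclideanSpace ℝ (Fin n))⟫)) (cdf (gaussianReal 0 1))
        ∂(sphereMeasure n)) := by
  have := isProbabilityMeasure_sphereMeasure hn
  rw [ofReal_integral_eq_lintegral_ofReal]
  · refine Integrable.of_bound
      ((measurable_kolmogorovDist μ).comp measurable_subtype_coe).aestronglyMeasurable 1
      (Filter.Eventually.of_forall fun θ ↦ ?_)
    have := isProbabilityMeasure_map_inner μ (θ : EuclideanSpace ℝ (Fin n))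
    rw [Real.norm_of_nonneg (kolmogorovDist_nonneg _ _)]
    exact kolmogorovDist_le_one _ _
  · exact Filter.Eventually.of_forall fun θ ↦ kolmogorovDist_nonneg _ _

lemma IsBoundedIsotropic.lintegral_frequencyEnergy_le_kolmogorovDist
    (h : IsBoundedIsotropic μ b σ) (hn : 0 < n) (hb : 1 ≤ b) {T l κ η : ℝ} (hT : 0 < T)
    (hl : 0 < l) (hκ : 0 < κ) (hη : 0 < η) :
    ∫⁻ θ, frequencyEnergy μ {u : ℝ | |u| ≤ T} θ ∂(sphereMeasure n) ≤
      ENNReal.ofReal (3 * l * κ * (∫ θ, kolmogorovDist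
        (cdf (μ.map fun v ↦ ⟪v, (θ : EuclideanSpace ℝ (Fin n))⟫)) (cdf (gaussianReal 0 1))
        ∂(sphereMeasure n)) + 3 * l * η +
        3 * l / η * (144 * b * Real.exp (-(κ ^ 2 / 2 * (2 * b)⁻¹))) +
        1 / l ^ 4 * (4 * 10 ^ 17 * T ^ 3 * (1 + σ) ^ 6 / n ^ 3)) := by
  have := isProbabilityMeasure_sphereMeasure hn
  have hσ := h.nonneg
  have hb0 : 0 < b := by linarith
  set R := ∫ θ, kolmogorovDist (cdf (μ.map fun v ↦ ⟪v, (θ : EuclideanSpace ℝ (Fin n))⟫))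
    (cdf (gaussianReal 0 1)) ∂(sphereMeasure n) with hR
  have hR0 : 0 ≤ R := integral_nonneg fun θ ↦ kolmogorovDist_nonneg _ _
  have hm : Measurable fun θ : Metric.sphere (0 : EuclideanSpace ℝ (Fin n)) 1 ↦
      kolmogorovDist (cdf (μ.map fun v ↦ ⟪v, (θ : EuclideanSpace ℝ (Fin n))⟫))
        (cdf (gaussianReal 0 1)) := (measurable_kolmogorovDist μ).comp measurable_subtype_coe
  have hm3 : Measurable fun θ : Metric.sphere (0 : EuclideanSpace ℝ (Fin n)) 1 ↦
      ENNReal.ofReal (1 / l ^ 4) * frequencyEnergy μ {u : ℝ | |u| ≤ T} θ ^ 3 :=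
    (((measurable_frequencyEnergy _).comp measurable_subtype_coe).pow_const 3).const_mul _
  refine (lintegral_mono (g := fun θ : Metric.sphere (0 : EuclideanSpace ℝ (Fin n)) 1 ↦
      ENNReal.ofReal (3 * l * κ) * ENNReal.ofReal (kolmogorovDist
      (cdf (μ.map fun v ↦ ⟪v, (θ : EuclideanSpace ℝ (Fin n))⟫)) (cdf (gaussianReal 0 1))) +
      ENNReal.ofReal (3 * l * η) + ENNReal.ofReal (3 * l / η) *
        (∫⁻ x in {x : ℝ | κ ^ 2 / 2 < |x|}, ENNReal.ofReal
          ((cdf (μ.map fun v ↦ ⟪v, (θ : EuclideanSpace ℝ (Fin n))⟫) x -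
          cdf (gaussianReal 0 1) x) ^ 2)) + ENNReal.ofReal (1 / l ^ 4) *
          frequencyEnergy μ {u : ℝ | |u| ≤ T} θ ^ 3) fun θ ↦ ?_).trans ?_
  · have := isProbabilityMeasure_map_inner μ (θ : EuclideanSpace ℝ (Fin n))
    exact lintegral_low_frequency_le (h.integrable_map_inner θ) integrable_id_gaussianReal T
      hl hκ.le hη
  · rw [lintegral_add_right _ hm3,
      lintegral_add_left ((hm.ennreal_ofReal.const_mul _).add_const _),
      lintegral_add_right _ measurable_const, lintegral_const, measure_univ, mul_one,
      lintegral_const_mul' _ _ ENNReal.ofReal_ne_top,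
      lintegral_const_mul' _ _ ENNReal.ofReal_ne_top,
      lintegral_const_mul' _ _ ENNReal.ofReal_ne_top, lintegral_ofReal_kolmogorovDist hn, ← hR,
      ENNReal.ofReal_add (by positivity) (by positivity),
      ENNReal.ofReal_add (by positivity) (by positivity),
      ENNReal.ofReal_add (by positivity) (by positivity),
      ENNReal.ofReal_mul (p := 3 * l * κ) (by positivity),
      ENNReal.ofReal_mul (p := 1 / l ^ 4) (by positivity),
      ENNReal.ofReal_mul (p := 3 * l / η) (by positivity)]
    gcongr
    · exact lintegral_sphere_cdf_tail_le hn hb h.bound (by positivity)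
    · exact h.lintegral_frequencyEnergy_pow_three_le hn hT

end

/-! ### Choice of the parameters. -/

lemma exp_neg_sq_div_le {T N : ℝ} (hN : 2 ≤ N) (hT : 16 * Real.log N ≤ T) :
    Real.exp (-(T ^ 2 / 64)) ≤ 1 / N := by
  have hL : 0.69 ≤ Real.log N :=
    (by linarith [Real.log_two_gt_d9] : (0.69 : ℝ) ≤ Real.log 2).trans
      (Real.log_le_log (by norm_num) hN)
  rw [one_div, ← Real.exp_log (by positivity : (0 : ℝ) < N⁻¹), Real.log_inv, Real.exp_le_exp]
  nlinarith

/-- An a priori upper bound for `D`. It guarantees that the cutoff `T`, proportional to `L² s²/D`,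
chosen later is at least `16 L`, as the exponential term requires. -/
lemma le_of_forall_frequency_bound {N s D : ℝ} (hN : 2 ≤ N) (hs : 1 ≤ s)
    (H : ∀ T q : ℝ, 0 < T → 0 < q → 2 * Real.pi * (D / N) ≤
      q + 1 / q ^ 2 * (4 * 10 ^ 17 * T ^ 3 * s ^ 6 / N ^ 3) +
        2048 / T * (2 * Real.exp (-(T ^ 2 / 64)) + 12 * s ^ 2 / N)) (hD : 0 < D) :
    D ≤ 10 ^ 7 * Real.log N * s ^ 2 := by
  have hL : 0.69 ≤ Real.log N :=
    (by linarith [Real.log_two_gt_d9] : (0.69 : ℝ) ≤ Real.log 2).trans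
      (Real.log_le_log (by norm_num) hN)
  have hexp := exp_neg_sq_div_le hN (le_refl (16 * Real.log N))
  set L := Real.log N
  -- With this `q`, the three terms have coefficients `10⁷`, `1.6384 · 10⁷` and at most `10⁴`, which
  -- together stay below `6 · 10⁷`, while `2π ≥ 6`.
  have h := H (16 * L) (10 ^ 7 * L * s ^ 2 / N) (by positivity) (by positivity)
  have h1 : 1 / (10 ^ 7 * L * s ^ 2 / N) ^ 2 * (4 * 10 ^ 17 * (16 * L) ^ 3 * s ^ 6 / N ^ 3) =
      1.6384 * 10 ^ 7 * L * s ^ 2 / N := by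
    field_simp
    ring
  have h2 : 2048 / (16 * L) * (2 * Real.exp (-((16 * L) ^ 2 / 64)) + 12 * s ^ 2 / N) ≤
      10 ^ 4 * L * s ^ 2 / N := by
    calc 2048 / (16 * L) * (2 * Real.exp (-((16 * L) ^ 2 / 64)) + 12 * s ^ 2 / N)
        ≤ 2048 / (16 * L) * (2 * (s ^ 2 / N) + 12 * s ^ 2 / N) := by
          gcongr
          exact hexp.trans (by gcongr; nlinarith)
      _ = 1792 / L * (s ^ 2 / N) := by
          field_simp
          ring
      _ ≤ 10 ^ 4 * L * (s ^ 2 / N) := by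
          gcongr
          rw [div_le_iff₀ (by positivity)]
          nlinarith
      _ = _ := by ring
  have h3 : 6 * (D / N) ≤ 2 * Real.pi * (D / N) := by
    gcongr
    linarith [Real.pi_gt_three]
  have h4 : 6 * (D / N) ≤ 6 * (10 ^ 7 * L * s ^ 2 / N) := by
    have h5 : 0 ≤ L * s ^ 2 / N := by positivity
    have e (a : ℝ) : a * L * s ^ 2 / N = a * (L * s ^ 2 / N) := by ring
    rw [h1] at h
    rw [e] at h h2 ⊢
    rw [e] at h
    linarith
  have h6 : D / N ≤ 10 ^ 7 * L * s ^ 2 / N := by linarith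
  rwa [div_le_div_iff_of_pos_right (by positivity)] at h6

lemma lower_bound_of_forall_frequency_bound {N s D b R : ℝ} (hN : 2 ≤ N) (hs : 1 ≤ s)
    (hb : 1 ≤ b) (hD : 0 < D)
    (H : ∀ T q : ℝ, 0 < T → 0 < q → 2 * Real.pi * (D / N) ≤
      q + 1 / q ^ 2 * (4 * 10 ^ 17 * T ^ 3 * s ^ 6 / N ^ 3) +
        2048 / T * (2 * Real.exp (-(T ^ 2 / 64)) + 12 * s ^ 2 / N))
    (H' : ∀ T l κ η : ℝ, 0 < T → 0 < l → 0 < κ → 0 < η → 2 * Real.pi * (D / N) ≤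
      3 * l * κ * R + 3 * l * η +
        3 * l / η * (144 * b * Real.exp (-(κ ^ 2 / 2 * (2 * b)⁻¹))) +
        1 / l ^ 4 * (4 * 10 ^ 17 * T ^ 3 * s ^ 6 / N ^ 3) +
        2048 / T * (2 * Real.exp (-(T ^ 2 / 64)) + 12 * s ^ 2 / N)) :
    1 / 10 ^ 12 / (s ^ 3 * b) * (D ^ 2 / (Real.log N ^ 4 * √N)) - 100 / N ≤ R := by
  have hL : 0.693 ≤ Real.log N :=
    (by linarith [Real.log_two_gt_d9] : (0.693 : ℝ) ≤ Real.log 2).trans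
      (Real.log_le_log (by norm_num) hN)
  have hDL := le_of_forall_frequency_bound hN hs H hD
  have hlog : Real.exp (-(2 * Real.log N)) = 1 / N ^ 2 := by
    rw [two_mul, neg_add, Real.exp_add, Real.exp_neg, Real.exp_log (by positivity)]
    field_simp
  have hT16 : 16 * Real.log N ≤ 1.6 * 10 ^ 8 * Real.log N ^ 2 * s ^ 2 / D := by
    rw [le_div_iff₀ hD]
    nlinarith
  have hexp := exp_neg_sq_div_le hN hT16
  set L := Real.log N
  have hL2 : 0.48 ≤ L ^ 2 := by nlinarith
  have hL3 : 0.33 ≤ L ^ 3 := by nlinarith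
  obtain ⟨r, hr, hrN⟩ : ∃ r : ℝ, 0 < r ∧ N = r ^ 2 :=
    ⟨√N, by positivity, (Real.sq_sqrt (by positivity)).symm⟩
  have hsq : √N = r := by rw [hrN, Real.sqrt_sq hr.le]
  rw [hsq]
  set T := 1.6 * 10 ^ 8 * L ^ 2 * s ^ 2 / D with hTdef
  set l := 10 ^ 11 * L ^ 2 * s ^ 3 / (D * r) with hldef
  have hT : 0 < T := by positivity
  have hl : 0 < l := by positivity
  -- `T` makes the high-frequency term at most `D/N`, and then `l` makes the third-moment term at
  -- most `D/N`; this leaves `4` of the `6 ≤ 2π`. With `κ = 5bL²` the tail exponent is `6.25 L⁴ b ≥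
  -- 2L`, so the tail is at most `N⁻²` and survives division by `η = b/N`.
  have h := H' T l (5 * b * L ^ 2) (b / N) hT hl (by positivity) (by positivity)
  have hV : 1 / l ^ 4 * (4 * 10 ^ 17 * T ^ 3 * s ^ 6 / N ^ 3) ≤ D / N := by
    have e : 1 / l ^ 4 * (4 * 10 ^ 17 * T ^ 3 * s ^ 6 / N ^ 3) =
        0.016384 / L ^ 2 * (D / N) := by
      rw [hTdef, hldef, hrN]
      field_simp
      ring
    rw [e]
    refine mul_le_of_le_one_left (by positivity) ?_
    rw [div_le_one (by positivity)]
    linarith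
  have hW : 2048 / T * (2 * Real.exp (-(T ^ 2 / 64)) + 12 * s ^ 2 / N) ≤ D / N := by
    calc 2048 / T * (2 * Real.exp (-(T ^ 2 / 64)) + 12 * s ^ 2 / N)
        ≤ 2048 / T * (2 * (s ^ 2 / N) + 12 * s ^ 2 / N) := by
          gcongr
          exact hexp.trans (by gcongr; nlinarith)
      _ = 0.0001792 / L ^ 2 * (D / N) := by
          rw [hTdef]
          field_simp
          ring
      _ ≤ D / N := by
          refine mul_le_of_le_one_left (by positivity) ?_
          rw [div_le_one (by positivity)]
          linarith
  have hX : 3 * l / (b / N) * (144 * b *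
      Real.exp (-((5 * b * L ^ 2) ^ 2 / 2 * (2 * b)⁻¹))) ≤ 432 * l * b / N := by
    calc 3 * l / (b / N) * (144 * b * Real.exp (-((5 * b * L ^ 2) ^ 2 / 2 * (2 * b)⁻¹)))
        ≤ 3 * l / (b / N) * (144 * b * (1 / N ^ 2)) := by
          rw [← hlog]
          gcongr 3 * l / (b / N) * (144 * b * ?_)
          refine Real.exp_le_exp.2 (neg_le_neg ?_)
          have e : (5 * b * L ^ 2) ^ 2 / 2 * (2 * b)⁻¹ = 6.25 * L ^ 3 * L * b := by
            field_simp
            ring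
          rw [e]
          calc 2 * L ≤ 6.25 * L ^ 3 * L * 1 := by nlinarith
            _ ≤ _ := by gcongr
      _ = 432 * l / N * 1 := by
          field_simp
          ring
      _ ≤ 432 * l / N * b := by gcongr
      _ = _ := by ring
  have h3 : 6 * (D / N) ≤ 2 * Real.pi * (D / N) := by
    gcongr
    linarith [Real.pi_gt_three]
  have hmain : 4 * (D / N) ≤ 15 * l * b * L ^ 2 * R + 435 * l * b / N := by
    have e1 : 3 * l * (5 * b * L ^ 2) * R = 15 * l * b * L ^ 2 * R := by ring
    have e2 : 3 * l * (b / N) + 432 * l * b / N = 435 * l * b / N := by ring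
    linarith
  -- The loss `29/(L² N)`, with `29 = 435/15`, is at most `100/N` because `L² ≥ 0.48`.
  have hR : 4 * (D / N) / (15 * l * b * L ^ 2) - 29 / (L ^ 2 * N) ≤ R := by
    rw [sub_le_iff_le_add, div_le_iff₀ (by positivity)]
    refine hmain.trans (le_of_eq ?_)
    field_simp
    ring
  refine le_trans (sub_le_sub ?_ ?_) hR
  · have e : 4 * (D / N) / (15 * l * b * L ^ 2) =
        4 / 15 / 10 ^ 11 / (s ^ 3 * b) * (D ^ 2 / (L ^ 4 * r)) := by
      rw [hldef, hrN]
      field_simp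
    rw [e]
    gcongr ?_ / _ * _
    norm_num
  · rw [div_le_div_iff₀ (by positivity) (by positivity)]
    nlinarith

/-! ### From an isotropic random vector to its law, and conclusion. -/

section

variable {n : ℕ} {Ω : Type*} [MeasurableSpace Ω] {P : Measure Ω} [IsProbabilityMeasure P]
  {X : Ω → EuclideanSpace ℝ (Fin n)} {b : ℝ}

lemma integral_inner_sq_of_isIsotropic (hX : Measurable X) (hiso : IsIsotropic P X)
    (hb : ∀ᵐ ω ∂P, ‖X ω‖ ≤ b * √n) (v : EuclideanSpace ℝ (Fin n)) :
    ∫ ω, ⟪v, X ω⟫ ^ 2 ∂P = ‖v‖ ^ 2 := by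
  have hi (i j : Fin n) : Integrable (fun ω ↦ X ω i * X ω j) P := by
    refine Integrable.of_bound (by fun_prop) ((b * √n) ^ 2) (hb.mono fun ω hω ↦ ?_)
    rw [norm_mul, sq]
    exact mul_le_mul ((PiLp.norm_apply_le _ i).trans hω) ((PiLp.norm_apply_le _ j).trans hω)
      (norm_nonneg _) ((norm_nonneg _).trans hω)
  have e (ω : Ω) : ⟪v, X ω⟫ ^ 2 = ∑ i, ∑ j, v i * v j * (X ω i * X ω j) := by
    rw [PiLp.inner_apply, sq, Finset.sum_mul_sum]
    refine Finset.sum_congr rfl fun i _ ↦ Finset.sum_congr rfl fun j _ ↦ ?_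
    simp only [RCLike.inner_apply, conj_trivial]
    ring
  simp_rw [e]
  rw [integral_finsetSum _ fun i _ ↦ integrable_finsetSum _ fun j _ ↦ (hi i j).const_mul _]
  simp_rw [integral_finsetSum _ fun j _ ↦ (hi _ j).const_mul _, integral_const_mul, hiso _ _]
  rw [EuclideanSpace.real_norm_sq_eq]
  simp [sq]

lemma integral_norm_sq_of_isIsotropic (hX : Measurable X) (hiso : IsIsotropic P X)
    (hb : ∀ᵐ ω ∂P, ‖X ω‖ ≤ b * √n) : ∫ ω, ‖X ω‖ ^ 2 ∂P = n := by
  have hi (i : Fin n) : Integrable (fun ω ↦ X ω i * X ω i) P := by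
    refine Integrable.of_bound (by fun_prop) ((b * √n) ^ 2) (hb.mono fun ω hω ↦ ?_)
    rw [norm_mul, sq]
    exact mul_le_mul ((PiLp.norm_apply_le _ i).trans hω) ((PiLp.norm_apply_le _ i).trans hω)
      (norm_nonneg _) ((norm_nonneg _).trans hω)
  simp_rw [EuclideanSpace.real_norm_sq_eq, sq]
  rw [integral_finsetSum _ fun i _ ↦ hi i]
  simp [hiso _ _]

lemma isBoundedIsotropic_map (hn : 0 < n) (hX : Measurable X) (hiso : IsIsotropic P X)
    (hb : ∀ᵐ ω ∂P, ‖X ω‖ ≤ b * √n) : IsBoundedIsotropic (P.map X) b (sigma4 P X) where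
  bound := (ae_map_iff hX.aemeasurable (measurableSet_le (by fun_prop) measurable_const)).2 hb
  second_moment v := by
    rw [integral_map hX.aemeasurable (by fun_prop)]
    exact integral_inner_sq_of_isIsotropic hX hiso hb v
  norm_sq := by
    have hn0 : (n : ℝ) ≠ 0 := by exact_mod_cast hn.ne'
    rw [integral_map hX.aemeasurable (by fun_prop), sigma4,
      Real.sq_sqrt (div_nonneg (variance_nonneg _ _) (by positivity)),
      variance_eq_integral (by fun_prop), integral_norm_sq_of_isIsotropic hX hiso hb, div_div,
      ← integral_div]
    refine le_of_eq (integral_congr_ae (Filter.Eventually.of_forall fun ω ↦ ?_))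
    simp only
    field_simp
  nonneg := Real.sqrt_nonneg _

/-- The mean of `‖X‖²` is `n` and cannot exceed `b² n`. -/
lemma one_le_of_isIsotropic (hn : 0 < n) (hX : Measurable X) (hiso : IsIsotropic P X)
    (hb : ∀ᵐ ω ∂P, ‖X ω‖ ≤ b * √n) : 1 ≤ b := by
  have hn0 : (0 : ℝ) < n := by exact_mod_cast hn
  have h1 : (n : ℝ) ≤ b ^ 2 * n := by
    rw [← integral_norm_sq_of_isIsotropic hX hiso hb]
    have : ∫ ω, ‖X ω‖ ^ 2 ∂P ≤ ∫ _, b ^ 2 * n ∂P := by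
      refine integral_mono_of_nonneg (Filter.Eventually.of_forall fun ω ↦ by positivity)
        (integrable_const _) (hb.mono fun ω hω ↦ ?_)
      calc ‖X ω‖ ^ 2 ≤ (b * √n) ^ 2 := by gcongr
        _ = b ^ 2 * n := by rw [mul_pow, Real.sq_sqrt hn0.le]
    simpa [integral_norm_sq_of_isIsotropic hX hiso hb] using this
  obtain ⟨ω, hω⟩ := hb.exists
  have h2 : 0 ≤ b := by
    have : 0 ≤ b * √n := (norm_nonneg _).trans hω
    exact nonneg_of_mul_nonneg_left this (by positivity)
  have h3 : 1 ≤ b ^ 2 := by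
    by_contra! hc
    nlinarith
  nlinarith

end

lemma IsBoundedIsotropic.kolmogorovDist_lower_bound {n : ℕ}
    {μ : Measure (EuclideanSpace ℝ (Fin n))} [IsProbabilityMeasure μ] {b σ D : ℝ}
    (h : IsBoundedIsotropic μ b σ) (hn : 2 ≤ n) (hb : 1 ≤ b) (hD : 0 < D)
    (hω : D / n ≤ ∫ θ, l2Dist (cdf (μ.map fun v ↦ ⟪v, (θ : EuclideanSpace ℝ (Fin n))⟫))
      (cdf (gaussianReal 0 1)) ^ 2 ∂(sphereMeasure n)) :
    1 / 10 ^ 12 / ((1 + σ) ^ 3 * b) * (D ^ 2 / (Real.log n ^ 4 * √n)) - 100 / n ≤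
      ∫ θ, kolmogorovDist (cdf (μ.map fun v ↦ ⟪v, (θ : EuclideanSpace ℝ (Fin n))⟫))
        (cdf (gaussianReal 0 1)) ∂(sphereMeasure n) := by
  have hn0 : 0 < n := by omega
  have hσ := h.nonneg
  have hR0 : 0 ≤ ∫ θ, kolmogorovDist (cdf (μ.map fun v ↦ ⟪v, (θ : EuclideanSpace ℝ (Fin n))⟫))
      (cdf (gaussianReal 0 1)) ∂(sphereMeasure n) :=
    integral_nonneg fun θ ↦ kolmogorovDist_nonneg _ _
  have hb0 : 0 < b := by linarith
  have hω' : ENNReal.ofReal (2 * Real.pi * (D / n)) ≤ ENNReal.ofReal (2 * Real.pi) *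
      ∫⁻ θ, ENNReal.ofReal (l2Dist (cdf (μ.map fun v ↦ ⟪v, (θ : EuclideanSpace ℝ (Fin n))⟫))
        (cdf (gaussianReal 0 1)) ^ 2) ∂(sphereMeasure n) := by
    rw [ENNReal.ofReal_mul (by positivity)]
    gcongr
    -- If the integral were undefined its value would be 0 by convention, contradicting the lower
    -- bound `D/n > 0`.
    have hint : Integrable (fun θ : Metric.sphere (0 : EuclideanSpace ℝ (Fin n)) 1 ↦
        l2Dist (cdf (μ.map fun v ↦ ⟪v, (θ : EuclideanSpace ℝ (Fin n))⟫))
          (cdf (gaussianReal 0 1)) ^ 2) (sphereMeasure n) := by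
      by_contra hc
      rw [integral_undef hc] at hω
      exact absurd hω (not_le.2 (by positivity))
    rw [← ofReal_integral_eq_lintegral_ofReal hint
      (Filter.Eventually.of_forall fun θ ↦ sq_nonneg _)]
    exact ENNReal.ofReal_le_ofReal hω
  refine lower_bound_of_forall_frequency_bound (by exact_mod_cast hn) (by linarith) hb hD ?_ ?_
  · intro T q hT hq
    have := hω'.trans ((h.lintegral_l2Dist_sq_le hn0 hT).trans
      (add_le_add_left (h.lintegral_frequencyEnergy_le hn0 hT hq) _))
    rwa [← ENNReal.ofReal_add (by positivity) (by positivity),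
      ENNReal.ofReal_le_ofReal_iff (by positivity)] at this
  · intro T l κ η hT hl hκ hη
    have := hω'.trans ((h.lintegral_l2Dist_sq_le hn0 hT).trans (add_le_add_left
      (h.lintegral_frequencyEnergy_le_kolmogorovDist hn0 hb hT hl hκ hη) _))
    rwa [← ENNReal.ofReal_add (by positivity) (by positivity),
      ENNReal.ofReal_le_ofReal_iff (by positivity)] at this

end RandomizedCLT

end

theorem theorem1p3 :
    ∃ c₀ : ℝ, 0 < c₀ ∧ ∃ c₁ : ℝ, 0 < c₁ ∧
      ∀ (n : ℕ), 2 ≤ n →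
      ∀ (Ω : Type*) [MeasurableSpace Ω] (P : Measure Ω) [IsProbabilityMeasure P]
        (X : Ω → EuclideanSpace ℝ (Fin n)) (b D : ℝ),
        Measurable X →
        RandomizedCLT.IsIsotropic P X →
        (∀ᵐ ω ∂P, ‖X ω‖ ≤ b * √(n : ℝ)) →
        0 < D →
        D / n ≤ ∫ θ, RandomizedCLT.l2Dist (RandomizedCLT.weightedSumCDF P X θ)
          RandomizedCLT.stdNormalCDF ^ 2 ∂(RandomizedCLT.sphereMeasure n) →
        c₀ / ((1 + RandomizedCLT.sigma4 P X) ^ 3 * b ^ 2) *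
            (D ^ 2 / (Real.log n ^ 4 * √(n : ℝ))) -
          c₁ * (1 + RandomizedCLT.sigma4 P X ^ 2) / n ≤
        ∫ θ, RandomizedCLT.kolmogorovDist (RandomizedCLT.weightedSumCDF P X θ)
          RandomizedCLT.stdNormalCDF ∂(RandomizedCLT.sphereMeasure n) := by
  refine ⟨1 / 10 ^ 12, by norm_num, 100, by norm_num,
    fun n hn Ω _ P _ X b D hX hiso hb hD hω ↦ ?_⟩
  have hn0 : 0 < n := by omega
  have : IsProbabilityMeasure (P.map X) := Measure.isProbabilityMeasure_map hX.aemeasurable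
  have h := RandomizedCLT.isBoundedIsotropic_map hn0 hX hiso hb
  have hb1 := RandomizedCLT.one_le_of_isIsotropic hn0 hX hiso hb
  have hF (θ : EuclideanSpace ℝ (Fin n)) : RandomizedCLT.weightedSumCDF P X θ =
      cdf ((P.map X).map fun v ↦ ⟪v, θ⟫) := by
    rw [RandomizedCLT.weightedSumCDF_map P hX, RandomizedCLT.weightedSumCDF_id]
  have hΦ : RandomizedCLT.stdNormalCDF = cdf (gaussianReal 0 1) := rfl
  simp_rw [hF, hΦ] at hω ⊢
  -- The bound just obtained is stronger: it has `b` in place of `b²`, where `b ≥ 1`, and no factor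
  -- `1 + σ₄²` in the error.
  refine le_trans (sub_le_sub ?_ ?_) (h.kolmogorovDist_lower_bound hn hb1 hD hω)
  · have hσ := h.nonneg
    have hb0 : 0 < b := by linarith
    gcongr
    nlinarith
  · gcongr
    nlinarith [sq_nonneg (RandomizedCLT.sigma4 P X)]
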